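/- Let $T$ be a complete NIP theory in a language $L$: no $L$-formula $\varphi(x,y)$ has, in a model of $T$, sequences $(a_i)_{i\in\mathbb N}$, $(b_I)_{I\subseteq\mathbb N}$ such that $\varphi(a_i,b_I)$ holds if and only if $i\in I$. Let $\bar M\models T$ and let $M\preceq\bar M$ be an elementary substructure. Assume that $\bar M$ is $\kappa$-saturated and either has cardinality $\kappa$ (that is, it is saturated) or is strongly $\kappa$-homogeneous, for some cardinal $\kappa>2^{2^{\lambda}}$, where $\lambda=\max(\aleph_0,|M|,|L|)$. Let $X\subseteq M^n$ be $M$-definable, and let $S_X(\bar M)$ be the set of complete $n$-types over $\bar M$ that contain the formula defining $X$. For an $L_{\bar M}$-formula $\psi(x)$ write $\psi(M)=\psi(\bar M)\cap M^n$ and $[\psi]=\{q\in S_X(\bar M):\psi\in q\}$. A type is $M$-invariant if it is fixed by all automorphisms of $\bar M$ that fix $M$ pointwise. An $L_{\bar M}$-formula $\theta(x)$ is honest over $M$ if, for every $L_M$-formula $\varphi(x)$, $\theta(M)\subseteq\varphi(M)$ implies $\theta(\bar M)\subseteq\varphi(\bar M)$. The honest topology on $S_X(\bar M)$ has as a basis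 of closed sets the sets $[\theta]$ with $\theta$ honest over $M$; its closure operator is $\mathrm{cl}^{\rm h}$. For an $M$-invariant $p\in S_X(\bar M)$, Simon's retraction $F_M(p)$ is the type $q$ over $\bar M$ such that, whenever $M\preceq M'\preceq\bar M$ with $M'$ being $|M|^+$-saturated, and $(N',N)$ with $N'\preceq\bar M$ is an $|M'|^+$-saturated elementary extension of the pair $(M',M)$ in the language $L\cup\{P\}$ (the predicate $P$ naming the smaller set), the set $p|_N(x)\cup\{P(x)\}\cup q|_{M'}(x)$ is consistent with the elementary diagram of $(N',N)$. Then, for every $M$-invariant $p\in S_X(\bar M)$, there is exactly one such type $F_M(p)$; it lies in $S_X(\bar M)$ and is finitely satisfiable in $M$. An $L_{\bar M}$-formula $\psi(x)$ belongs to $F_M(p)$ if and only if there is an $L_{\bar M}$-formula $\theta(x)\in p$, honest over $M$, such that $\theta(M)=\psi(M)$. Consequently $$F_M(p)\in\bigcap\{[\theta]:\theta\in p\text{ honest over }M\}=\mathrm{cl}^{\rm h}(p).$$ -/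

import Mathlib

open FirstOrder FirstOrder.Language Cardinal

universe u v w

namespace Honest

/-! ### Saturation, homogeneity, NIP -/

/-- `A` is `κ`-saturated: every set of formulas in one variable with parameters in a set of size
`< κ` which is finitely satisfiable in `A` is realized in `A`. -/
def IsSaturated (L : FirstOrder.Language.{u, v}) (κ : Cardinal.{w}) (A : Type w)
    [L.Structure A] : Prop :=
  ∀ B : Set A, #B < κ → ∀ Γ : Set (L[[B]].Formula (Fin 1)),
    (∀ Γ₀ : Finset (L[[B]].Formula (Fin 1)), (Γ₀ : Set (L[[B]].Formula (Fin 1))) ⊆ Γ →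
      ∃ a : Fin 1 → A, ∀ φ ∈ Γ₀, φ.Realize a) →
    ∃ a : Fin 1 → A, ∀ φ ∈ Γ, φ.Realize a

/-- `A` is strongly `κ`-homogeneous: every partial elementary map of `A` whose domain has size
`< κ` extends to an automorphism of `A`. -/
def IsStronglyHomogeneous (L : FirstOrder.Language.{u, v}) (κ : Cardinal.{w}) (A : Type w)
    [L.Structure A] : Prop :=
  ∀ B : Set A, #B < κ → ∀ f : B → A,
    (∀ φ : L.Formula B, φ.Realize (fun b : B => (b : A)) ↔ φ.Realize f) →
    ∃ σ : A ≃[L] A, ∀ b : B, σ (b : A) = f b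

/-- `A` is `κ`-saturated and, moreover, either has cardinality `κ` (so that it is saturated in the
literal sense) or is strongly `κ`-homogeneous. -/
structure IsMonster (L : FirstOrder.Language.{u, v}) (κ : Cardinal.{w}) (A : Type w)
    [L.Structure A] : Prop where
  saturated : IsSaturated L κ A
  card_eq_or_homogeneous : #A = κ ∨ IsStronglyHomogeneous L κ A

/-- The theory `T` is NIP: no formula `φ(x, y)` has, in some model of `T`, sequences `(aᵢ)`,
`i ∈ ℕ`, and `(b_I)`, `I ⊆ ℕ`, such that `φ(aᵢ, b_I)` holds if and only if `i ∈ I`. -/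
def IsNIP {L : FirstOrder.Language.{u, v}} (T : L.Theory) : Prop :=
  ∀ (k l : ℕ) (φ : L.Formula (Fin k ⊕ Fin l)) (A : Theory.ModelType.{u, v, w} T),
    ¬ ∃ (a : ℕ → Fin k → A) (b : Set ℕ → Fin l → A),
      ∀ (i : ℕ) (I : Set ℕ), φ.Realize (Sum.elim (a i) (b I)) ↔ i ∈ I

/-! ### Formulas with parameters and types over a structure -/

section Types

variable {L : FirstOrder.Language.{u, v}} {Mbar : Type w} [L.Structure Mbar] {n : ℕ}

/-- A formula with parameters in `A ⊆ Mbar`, seen as a formula with parameters in `Mbar`. -/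
def withParams (A : Set Mbar) (φ : L[[A]].Formula (Fin n)) : L[[Mbar]].Formula (Fin n) :=
  (L.lhomWithConstantsMap (fun a : A => (a : Mbar))).onFormula φ

/-- A formula with parameters in the elementary substructure `M`, seen as a formula with
parameters in `Mbar`. -/
def ofModel (M : L.ElementarySubstructure Mbar) (φ : L[[M]].Formula (Fin n)) :
    L[[Mbar]].Formula (Fin n) :=
  withParams (M : Set Mbar) φ

variable (L Mbar n) in
/-- `S_n(Mbar)`: the complete `n`-types over `Mbar`. -/
abbrev TypeSpace [Nonempty Mbar] : Type (max u v w) :=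
  (L.elementaryDiagram Mbar).CompleteType (Fin n)

variable [Nonempty Mbar]

/-- The formula `φ(x)` with parameters in `Mbar` belongs to the type `p(x)`. -/
def InType (φ : L[[Mbar]].Formula (Fin n)) (p : TypeSpace L Mbar n) : Prop :=
  Formula.equivSentence φ ∈ p

/-- The restriction `p|_A`: the formulas of `p` with parameters in `A`. -/
def restrictTo (p : TypeSpace L Mbar n) (A : Set Mbar) : Set (L[[Mbar]].Formula (Fin n)) :=
  {φ | InType φ p ∧ ∃ φ₀ : L[[A]].Formula (Fin n), withParams A φ₀ = φ}

/-- `p` is `M`-invariant: `σ(p) = p` for each automorphism `σ` of `Mbar` fixing `M` pointwise,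
where `σ(p) = {ψ(x, σ(b)) : ψ(x, b) ∈ p}`. -/
def IsInvariant (M : L.ElementarySubstructure Mbar) (p : TypeSpace L Mbar n) : Prop :=
  ∀ σ : Mbar ≃[L] Mbar, (∀ m ∈ M, σ m = m) →
    (fun ψ : L[[Mbar]].Formula (Fin n) => (L.lhomWithConstantsMap σ).onFormula ψ) ''
      {ψ | InType ψ p} = {ψ | InType ψ p}

/-- The trace `ψ(M) = ψ(Mbar) ∩ Mⁿ`. -/
def trace (M : L.ElementarySubstructure Mbar) (ψ : L[[Mbar]].Formula (Fin n)) :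
    Set (Fin n → Mbar) :=
  {a | (∀ i, a i ∈ M) ∧ ψ.Realize a}

/-- `p` is finitely satisfiable in `M`. -/
def IsFinSat (M : L.ElementarySubstructure Mbar) (p : TypeSpace L Mbar n) : Prop :=
  ∀ ψ : L[[Mbar]].Formula (Fin n), InType ψ p → (trace M ψ).Nonempty

/-- `θ` is honest over `M`. -/
def IsHonest (M : L.ElementarySubstructure Mbar) (θ : L[[Mbar]].Formula (Fin n)) : Prop :=
  ∀ φ : L[[M]].Formula (Fin n), trace M θ ⊆ trace M (ofModel M φ) →
    ∀ a : Fin n → Mbar, θ.Realize a → (ofModel M φ).Realize a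

/-- `S_X(Mbar)`, where `X` is the set defined by the formula `χ` with parameters in `M`. -/
def TypesOn (M : L.ElementarySubstructure Mbar) (χ : L[[M]].Formula (Fin n)) :
    Type (max u v w) :=
  {p : TypeSpace L Mbar n // InType (ofModel M χ) p}

/-- The set `[θ]` of the types in `S_X(Mbar)` containing `θ`. -/
def typesContaining (M : L.ElementarySubstructure Mbar) (χ : L[[M]].Formula (Fin n))
    (θ : L[[Mbar]].Formula (Fin n)) : Set (TypesOn M χ) :=
  {p | InType θ p.1}

/-- The honest topology over `M` on `S_X(Mbar)`, in which the sets `[θ]` with `θ` honest over `M`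
are the basic closed sets. -/
instance honestTopology (M : L.ElementarySubstructure Mbar) (χ : L[[M]].Formula (Fin n)) :
    TopologicalSpace (TypesOn M χ) :=
  TopologicalSpace.generateFrom
    {U | ∃ θ : L[[Mbar]].Formula (Fin n), IsHonest M θ ∧ U = (typesContaining M χ θ)ᶜ}

end Types

/-! ### Pairs of models and Simon's retraction -/

/-- The relation symbols of the language with one unary predicate. -/
inductive PredSymbol : ℕ → Type
  | P : PredSymbol 1

/-- The language with one unary predicate `P`. -/
def predLanguage : FirstOrder.Language.{0, 0} := ⟨fun _ => Empty, PredSymbol⟩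

/-- The language `L_P = L ∪ {P}`. -/
abbrev pairLanguage (L : FirstOrder.Language.{u, v}) : FirstOrder.Language.{u, v} :=
  L.sum predLanguage

/-- The underlying set of the pair `(A, S)`, where `S` is the interpretation of `P`. -/
def PairOf (A : Type w) (_S : Set A) : Type w := A

/-- An element of the pair `(A, S)`, seen as an element of `A`. -/
def PairOf.toBase {A : Type w} {S : Set A} (x : PairOf A S) : A := x

/-- An element of `A`, seen as an element of the pair `(A, S)`. -/
def PairOf.ofBase {A : Type w} (S : Set A) (x : A) : PairOf A S := x

instance pairBase (L : FirstOrder.Language.{u, v}) (A : Type w) [h : L.Structure A] (S : Set A) :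
    L.Structure (PairOf A S) := h

instance pairPred (A : Type w) (S : Set A) : predLanguage.Structure (PairOf A S) where
  funMap := fun f _ => nomatch f
  RelMap := fun r x => match r, x with
    | PredSymbol.P, x => x 0 ∈ S

section Retraction

variable {L : FirstOrder.Language.{u, v}} {Mbar : Type w} [L.Structure Mbar] {n : ℕ}

/-- The pair `(A, S)` for an elementary substructure `A` of `Mbar` and a set `S`. -/
abbrev pairIn (A : L.ElementarySubstructure Mbar) (S : Set Mbar) : Type w :=
  PairOf A {x : A | (x : Mbar) ∈ S}

/-- The auxiliary models in the construction of `F_M`: models `M'` and `N'` inside `Mbar` such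
that `M'` is an `|M|⁺`-saturated elementary extension of `M` and `(N', N)` is an
`|M'|⁺`-saturated elementary extension of the `L_P`-structure `(M', M)`. -/
structure SimonPair (M : L.ElementarySubstructure Mbar) where
  /-- the model `M'` -/
  M' : L.ElementarySubstructure Mbar
  /-- the model `N'` -/
  N' : L.ElementarySubstructure Mbar
  /-- the interpretation `N` of `P` in `N'` -/
  N : Set Mbar
  M_le : (M : Set Mbar) ⊆ M'
  saturated_M' : IsSaturated L (Order.succ #M) M'
  N_sub : N ⊆ N'
  elementary : ∃ f : pairIn M' (M : Set Mbar) ↪ₑ[pairLanguage L] pairIn N' N,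
    ∀ x : M', ((f (PairOf.ofBase _ x)).toBase : Mbar) = x
  saturated_pair : IsSaturated (pairLanguage L) (Order.succ #M') (pairIn N' N)

/-- For a set `Γ(x)` of formulas with parameters in `N'`, consistency of `Γ(x) ∪ {P(x)}` with the
elementary diagram of the pair `(N', N)`, that is, finite satisfiability of `Γ(x) ∪ {P(x)}` in
`(N', N)`. Here truth in `N'` is the same as truth in `Mbar`, as `N' ≼ Mbar`. -/
def ConsistentWithP (N : Set Mbar) (Γ : Set (L[[Mbar]].Formula (Fin n))) : Prop :=
  ∀ Γ₀ : Finset (L[[Mbar]].Formula (Fin n)), (Γ₀ : Set (L[[Mbar]].Formula (Fin n))) ⊆ Γ →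
    ∃ a : Fin n → Mbar, (∀ i, a i ∈ N) ∧ ∀ φ ∈ Γ₀, φ.Realize a

variable [Nonempty Mbar]

/-- The type `q` over `Mbar` is the value `F_M(p)` of Simon's retraction at `p`: for all auxiliary
models `M'`, `(N', N)` the set `p|_N ∪ {P(x)} ∪ q|_{M'}` is consistent. -/
def IsSimonRetract (M : L.ElementarySubstructure Mbar) (p q : TypeSpace L Mbar n) : Prop :=
  ∀ D : SimonPair M,
    ConsistentWithP D.N (restrictTo p D.N ∪ restrictTo q (D.M' : Set Mbar))

end Retraction

end Honest

/-! Represent $p$ by an ultrafilter $U$ on $\bar M^n$ and fix auxiliary models $M'$, $(N',N)$. For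
$M'$-definable $Y$, `SimonPair.Con` says that $p|_N\cup\{P(x)\}$ is consistent with $Y$. The heart
is the dichotomy `SimonPair.not_con_and_con_compl`: $Y$ and its complement are never both
consistent. Otherwise saturation of the pair yields a Morley sequence of $p$ over $M$ inside $N$
which lies alternately in and out of $Y$; invariance of $p$ makes it indiscernible, and NIP forbids
the alternation. As $N$ satisfies the Tarski-Vaught test, at least one of the two is consistent, so
$p$ determines a complete type over $M'$.

This type must be shown not to depend on the auxiliary models. If $Y^c$ is inconsistent, some
$N$-definable $X\in p$ has $X(N)\subseteq Y$. The dichotomy for types concentrated on $M$ gives an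
honest definition: an $N$-definable $\Theta$ with $Y(M)\subseteq\Theta$ and $\Theta(N)\subseteq Y$.
Then $X\cup\Theta$ lies in $p$, is honest, and has the trace of $Y$ on $M$
(`SimonPair.exists_isHonestSet`). Conversely, honesty says that an $M$-definable set meeting $Y$
meets it in $M$; this transfers to $N$, so an honest $Y\in p$ cannot be excluded on $N$
(`SimonPair.not_con_compl_of_isHonestSet`). Hence membership in $F_M(p)$ is having the trace of an
honest set in $p$ (`honestTrace_iff_not_con_compl`), a condition free of the auxiliary models.
Existence, uniqueness and finite satisfiability follow from it.

Enough auxiliary models exist because $\kappa>2^{2^\lambda}$ (`exists_simonPair`): a saturated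
extension of size $2^\lambda$, then one of the resulting pair of size $2^{2^\lambda}$, are embedded
into $\bar M$. -/

namespace Honest

/-! ### Tuples with the same type -/

section EqType

variable {L : FirstOrder.Language.{u, v}} {α β : Type*} {X Y : Type*}
  [L.Structure X] [L.Structure Y]

variable (L) in
/-- The tuples `f` and `g` satisfy the same formulas. -/
def EqType (f : α → X) (g : α → Y) : Prop :=
  ∀ φ : L.Formula α, φ.Realize f ↔ φ.Realize g

theorem EqType.comp {f : α → X} {g : α → Y} (h : EqType L f g) (s : β → α) :
    EqType L (f ∘ s) (g ∘ s) := fun φ => by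
  simpa [Formula.realize_relabel] using h (φ.relabel s)

theorem EqType.symm {f : α → X} {g : α → Y} (h : EqType L f g) : EqType L g f :=
  fun φ => (h φ).symm

/-- A formula has finitely many free variables. This is the finite character that lets chains of
elementary relations be united. -/
theorem EqType.of_finset {f : α → X} {g : α → Y}
    (h : ∀ t : Finset α, EqType L (fun i : t => f i) (fun i : t => g i)) : EqType L f g := by
  classical
  intro φ
  have := h φ.freeVarFinset (φ.restrictFreeVar id)
  rw [Formula.Realize, BoundedFormula.realize_restrictFreeVar f (by simp)] at this
  rw [Formula.Realize, BoundedFormula.realize_restrictFreeVar g (by simp)] at this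
  exact this

theorem EqType.eq_iff {f : α → X} {g : α → Y} (h : EqType L f g) (i j : α) :
    f i = f j ↔ g i = g j := by
  simpa using h ((Term.var i).equal (Term.var j))

theorem realize_constantsVarsEquiv_symm {B : Set X} (φ : L.Formula (B ⊕ α)) (a : α → X) :
    Formula.Realize (BoundedFormula.constantsVarsEquiv.symm φ : L[[B]].Formula α) a ↔
      φ.Realize (Sum.elim (fun b : B => (b : X)) a) := by
  have := BoundedFormula.realize_constantsVarsEquiv
    (φ := (BoundedFormula.constantsVarsEquiv.symm φ : L[[B]].Formula α)) (v := a)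
    (xs := default)
  rw [Equiv.apply_symm_apply] at this
  exact this.symm

theorem realize_constantsVarsEquiv {B : Set X} (φ : L[[B]].Formula α) (a : α → X) :
    Formula.Realize (BoundedFormula.constantsVarsEquiv φ : L.Formula (B ⊕ α))
      (Sum.elim (fun b : B => (b : X)) a) ↔ φ.Realize a := by
  rw [← realize_constantsVarsEquiv_symm, Equiv.symm_apply_apply]

/-- The conjunction of a finite set of formulas. -/
theorem exists_conj (Γ : Finset (L.Formula α)) : ∃ φ : L.Formula α,
    (∀ v : α → X, φ.Realize v ↔ ∀ ψ ∈ Γ, ψ.Realize v) ∧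
    (∀ v : α → Y, φ.Realize v ↔ ∀ ψ ∈ Γ, ψ.Realize v) := by
  refine ⟨Formula.iInf fun ψ : Γ => (ψ : L.Formula α), fun v => ?_, fun v => ?_⟩ <;>
  simp [Formula.realize_iInf]

end EqType

/-! ### Saturation and extension of elementary relations -/

section Saturation

variable {L : FirstOrder.Language.{u, v}} {X Y : Type w} [L.Structure X] [L.Structure Y]
  {κ : Cardinal.{w}}

theorem IsSaturated.exists_realize (hY : IsSaturated L κ Y) {I : Type w} (hI : #I < κ)
    (b : I → Y) (Γ : Set (L.Formula (I ⊕ Fin 1)))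
    (hΓ : ∀ Γ₀ : Finset (L.Formula (I ⊕ Fin 1)), (Γ₀ : Set _) ⊆ Γ →
      ∃ a : Y, ∀ φ ∈ Γ₀, φ.Realize (Sum.elim b fun _ => a)) :
    ∃ a : Y, ∀ φ ∈ Γ, φ.Realize (Sum.elim b fun _ => a) := by
  classical
  let conv : L.Formula (I ⊕ Fin 1) → L[[Set.range b]].Formula (Fin 1) := fun φ =>
    BoundedFormula.constantsVarsEquiv.symm
      (Formula.relabel (Sum.map (Set.rangeFactorization b) id) φ)
  have hconv : ∀ φ (a : Fin 1 → Y), (conv φ).Realize a ↔ φ.Realize (Sum.elim b fun _ => a 0) := by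
    intro φ a
    rw [realize_constantsVarsEquiv_symm, Formula.realize_relabel]
    have : Sum.elim (fun x : Set.range b => (x : Y)) a ∘ Sum.map (Set.rangeFactorization b) id
        = Sum.elim b fun _ => a 0 := by
      funext i
      rcases i with i | i
      · rfl
      · simp [Subsingleton.elim i 0]
    rw [this]
  obtain ⟨a, ha⟩ := hY (Set.range b) (Cardinal.mk_range_le.trans_lt hI) (conv '' Γ) (by
    intro Γ₀ h₀
    obtain ⟨Γ₁, h₁, rfl⟩ := Finset.subset_set_image_iff.1 h₀
    obtain ⟨a, ha⟩ := hΓ Γ₁ h₁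
    refine ⟨fun _ => a, fun φ hφ => ?_⟩
    obtain ⟨ψ, hψ, rfl⟩ := Finset.mem_image.1 hφ
    exact (hconv _ _).2 (ha ψ hψ))
  exact ⟨a 0, fun φ hφ => (hconv _ _).1 (ha _ ⟨φ, hφ, rfl⟩)⟩

theorem IsSaturated.of_exists_realize
    (h : ∀ (B : Set Y), #B < κ → ∀ Γ : Set (L.Formula (B ⊕ Fin 1)),
      (∀ Γ₀ : Finset (L.Formula (B ⊕ Fin 1)), (Γ₀ : Set _) ⊆ Γ →
        ∃ a : Y, ∀ φ ∈ Γ₀, φ.Realize (Sum.elim (fun b : B => (b : Y)) fun _ => a)) →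
      ∃ a : Y, ∀ φ ∈ Γ, φ.Realize (Sum.elim (fun b : B => (b : Y)) fun _ => a)) :
    IsSaturated L κ Y := by
  classical
  intro B hB Γ hΓ
  let conv : L[[B]].Formula (Fin 1) → L.Formula (B ⊕ Fin 1) := fun φ =>
    BoundedFormula.constantsVarsEquiv φ
  have hconv : ∀ φ (a : Y), (conv φ).Realize (Sum.elim (fun b : B => (b : Y)) fun _ => a) ↔
      φ.Realize fun _ => a := fun φ a => realize_constantsVarsEquiv φ fun _ => a
  obtain ⟨a, ha⟩ := h B hB (conv '' Γ) (by
    intro Γ₀ h₀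
    obtain ⟨Γ₁, h₁, rfl⟩ := Finset.subset_set_image_iff.1 h₀
    obtain ⟨a, ha⟩ := hΓ Γ₁ h₁
    refine ⟨a 0, fun φ hφ => ?_⟩
    obtain ⟨ψ, hψ, rfl⟩ := Finset.mem_image.1 hφ
    rw [hconv]
    convert ha ψ hψ)
  exact ⟨fun _ => a, fun φ hφ => (hconv _ _).1 (ha _ ⟨φ, hφ, rfl⟩)⟩

theorem IsSaturated.mono {κ' : Cardinal.{w}} (h : IsSaturated L κ Y) (hle : κ' ≤ κ) :
    IsSaturated L κ' Y := fun B hB => h B (hB.trans_le hle)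

variable (L) in
/-- The relation `R` is elementary: the tuples of first and second coordinates of its elements
satisfy the same formulas. -/
def ElemRel (R : Set (X × Y)) : Prop :=
  EqType L (fun r : R => r.1.1) (fun r : R => r.1.2)

theorem ElemRel.eqType {R : Set (X × Y)} (h : ElemRel L R) {α : Type*} {f : α → X} {g : α → Y}
    (hfg : ∀ i, (f i, g i) ∈ R) : EqType L f g :=
  h.comp fun i => ⟨(f i, g i), hfg i⟩

theorem elemRel_range {α : Type*} {f : α → X} {g : α → Y} (h : EqType L f g) :
    ElemRel L (Set.range fun i => (f i, g i)) := by
  have := h.comp fun r : Set.range fun i => (f i, g i) => r.2.choose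
  have h1 : (fun r : Set.range fun i => (f i, g i) => r.1.1) = f ∘ fun r => r.2.choose :=
    funext fun r => congrArg Prod.fst r.2.choose_spec.symm
  have h2 : (fun r : Set.range fun i => (f i, g i) => r.1.2) = g ∘ fun r => r.2.choose :=
    funext fun r => congrArg Prod.snd r.2.choose_spec.symm
  rw [ElemRel, h1, h2]
  exact this

theorem ElemRel.mono {R R' : Set (X × Y)} (h : ElemRel L R') (hR : R ⊆ R') : ElemRel L R :=
  h.eqType fun r => hR r.2

theorem ElemRel.sUnion {C : Set (Set (X × Y))} (hC : ∀ R ∈ C, ElemRel L R)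
    (hdir : DirectedOn (· ⊆ ·) C) (hne : C.Nonempty) : ElemRel L (⋃₀ C) := by
  classical
  refine EqType.of_finset fun t => ?_
  have hfin : ((t.image Subtype.val : Finset (X × Y)) : Set (X × Y)) ⊆ ⋃₀ C := by
    intro x hx
    simp only [Finset.coe_image, Set.mem_image] at hx
    obtain ⟨y, -, rfl⟩ := hx
    exact y.2
  obtain ⟨R, hR, hsub⟩ := hdir.exists_mem_subset_of_finset_subset_biUnion (f := id) hne
    (s := t.image Subtype.val) (by simpa [Set.sUnion_eq_biUnion] using hfin)
  exact (hC R hR).eqType fun i =>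
    hsub (Finset.mem_coe.2 (Finset.mem_image_of_mem _ i.2))

theorem ElemRel.image_swap {R : Set (X × Y)} (h : ElemRel L R) :
    ElemRel L (Prod.swap '' R) := by
  refine EqType.symm (h.eqType fun r => ?_)
  obtain ⟨⟨a, b⟩, hr, h'⟩ := r.2
  rw [← h']
  exact hr

/-- The type of `x` over the first coordinates, moved to the second ones, is finitely satisfiable,
since `R` preserves the existential closure of each finite conjunction. -/
theorem ElemRel.exists_insert {R : Set (X × Y)} (h : ElemRel L R) (hY : IsSaturated L κ Y)
    (hR : #R < κ) (x : X) : ∃ y : Y, ElemRel L (insert (x, y) R) := by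
  classical
  obtain ⟨y, hy⟩ := hY.exists_realize hR (fun r : R => r.1.2)
    {φ | φ.Realize (Sum.elim (fun r : R => r.1.1) fun _ => x)} (by
      intro Γ₀ h₀
      obtain ⟨ψ, hψ, hψ'⟩ := exists_conj (X := X) (Y := Y) Γ₀
      have h1 : (ψ.iExs (Fin 1)).Realize (fun r : R => r.1.1) := by
        rw [Formula.realize_iExs]
        exact ⟨fun _ => x, (hψ _).2 fun φ hφ => h₀ hφ⟩
      rw [h, Formula.realize_iExs] at h1
      obtain ⟨a, ha⟩ := h1
      refine ⟨a 0, ?_⟩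
      rw [← hψ']
      convert ha using 2
      funext i
      rw [Subsingleton.elim i 0])
  refine ⟨y, ?_⟩
  have key : EqType L (Sum.elim (fun r : R => r.1.1) fun _ : Fin 1 => x)
      (Sum.elim (fun r : R => r.1.2) fun _ : Fin 1 => y) := by
    intro φ
    refine ⟨fun hφ => hy _ hφ, fun hφ => ?_⟩
    by_contra hn
    exact hy φ.not hn hφ
  refine (elemRel_range key).mono ?_
  rintro r (rfl | hr)
  · exact ⟨Sum.inr 0, rfl⟩
  · exact ⟨Sum.inl ⟨r, hr⟩, rfl⟩

theorem ElemRel.exists_extend {R : Set (X × Y)} (h : ElemRel L R) (hY : IsSaturated L κ Y)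
    (hκ : ℵ₀ ≤ κ) (hR : #R < κ) (S : Set X) (hS : #S < κ) :
    ∃ R', R ⊆ R' ∧ ElemRel L R' ∧ ∀ s ∈ S, ∃ y, (s, y) ∈ R' := by
  -- The last clause confines new first coordinates to `S`. An elementary relation is the graph of
  -- an injection, so the clause keeps a maximal `R'` of size below `κ` and `exists_insert` still
  -- applies to it.
  obtain ⟨R', hsub, hmax⟩ := zorn_subset_nonempty
    {R' : Set (X × Y) | R ⊆ R' ∧ ElemRel L R' ∧ ∀ r ∈ R', r ∈ R ∨ r.1 ∈ S} (by
      intro C hC hchain hne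
      refine ⟨⋃₀ C, ⟨?_, ElemRel.sUnion (fun R hR => (hC hR).2.1) hchain.directedOn hne, ?_⟩,
        fun s hs => Set.subset_sUnion_of_mem hs⟩
      · obtain ⟨R₁, h₁⟩ := hne
        exact (hC h₁).1.trans (Set.subset_sUnion_of_mem h₁)
      · rintro r ⟨R₁, h₁, hr⟩
        exact (hC h₁).2.2 r hr) R ⟨subset_rfl, h, fun r hr => Or.inl hr⟩
  obtain ⟨-, hel, hdom⟩ := hmax.prop
  refine ⟨R', hsub, hel, fun s hs => ?_⟩
  have hcard : #R' < κ := by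
    have hinj : ∀ r r' : R', r.1.1 = r'.1.1 → r = r' := by
      intro r r' hrr
      exact Subtype.ext (Prod.ext hrr ((hel.eq_iff r r').1 hrr))
    have : R' ⊆ R ∪ {r ∈ R' | r.1 ∈ S} := fun r hr =>
      (hdom r hr).imp id fun h => ⟨hr, h⟩
    refine (Cardinal.mk_le_mk_of_subset this).trans_lt
      ((Cardinal.mk_union_le _ _).trans_lt (Cardinal.add_lt_of_lt hκ hR (lt_of_le_of_lt ?_ hS)))
    refine Cardinal.mk_le_of_injective
      (f := fun r : {r : X × Y | r ∈ R' ∧ r.1 ∈ S} => (⟨r.1.1, r.2.2⟩ : S)) ?_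
    intro r r' hrr
    have h3 := hinj ⟨r.1, r.2.1⟩ ⟨r'.1, r'.2.1⟩ (congrArg Subtype.val hrr)
    have h4 : r.1 = r'.1 := congrArg (fun r : R' => r.1) h3
    exact Subtype.ext h4
  obtain ⟨y, hy⟩ := hel.exists_insert hY hcard s
  refine ⟨y, hmax.le_of_ge ⟨hsub.trans (Set.subset_insert _ _), hy, ?_⟩ (Set.subset_insert _ _)
    (Set.mem_insert _ _)⟩
  rintro r (rfl | hr)
  · exact Or.inr hs
  · exact hdom r hr

end Saturation

/-! ### Finite intersection property and ultrapowers -/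

section FIP

variable {W : Type*}

/-- The finite intersection property. -/
def FIP (𝒳 : Set (Set W)) : Prop :=
  ∀ t : Set (Set W), t ⊆ 𝒳 → t.Finite → (⋂₀ t).Nonempty

theorem FIP.exists_ultrafilter {𝒳 : Set (Set W)} (h : FIP 𝒳) :
    ∃ U : Ultrafilter W, ∀ X ∈ 𝒳, X ∈ U := by
  have : (Filter.generate 𝒳).NeBot := Filter.generate_neBot_iff.2 fun t ht hf => h t ht hf
  exact ⟨Ultrafilter.of _, fun X hX =>
    Ultrafilter.of_le (Filter.generate 𝒳) (Filter.mem_generate_of_mem hX)⟩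

theorem FIP.of_ultrafilter {𝒳 : Set (Set W)} (U : Ultrafilter W) (h : ∀ X ∈ 𝒳, X ∈ U) :
    FIP 𝒳 := fun _ ht hfin =>
  U.nonempty_of_mem ((Filter.sInter_mem hfin).2 fun X hX => h X (ht hX))

end FIP

section Ultrapower

variable {L : FirstOrder.Language.{u, v}} {Y : Type w} [L.Structure Y] [Nonempty Y]
  {κ : Cardinal.{w}}

/-- The ultrapower of `Y` along `U`. -/
abbrev Ultrapower {W : Type w} (U : Ultrafilter W) (Y : Type w) : Type w :=
  (U : Filter W).Product fun _ => Y

/-- The element of the ultrapower represented by a function. -/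
def Ultrapower.mk {W : Type w} (U : Ultrafilter W) (f : W → Y) : Ultrapower U Y :=
  (f : (U : Filter W).Product fun _ => Y)

theorem Ultrapower.realize_mk {W : Type w} (U : Ultrafilter W) {α : Type*} (φ : L.Formula α)
    (f : α → W → Y) :
    φ.Realize (fun i => Ultrapower.mk U (f i)) ↔ {w | φ.Realize fun i => f i w} ∈ U :=
  Ultraproduct.realize_formula_cast φ f

theorem Ultrapower.eqType_const {W : Type w} (U : Ultrafilter W) {α : Type*} (f : α → Y) :
    EqType L (fun i => Ultrapower.mk U fun _ => f i) f := fun φ => by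
  rw [Ultrapower.realize_mk]
  by_cases h : φ.Realize f
  · simp only [h, iff_true]
    exact Filter.univ_mem
  · simp only [h, iff_false]
    exact U.empty_notMem

/-- In a `κ`-saturated structure, a family of sets definable over fewer than `κ` parameters, in
fewer than `κ` variables, has a common element if it has the finite intersection property. -/
theorem IsSaturated.exists_mem_of_fip (hY : IsSaturated L κ Y) (hκ : ℵ₀ ≤ κ) {V : Type w}
    (hV : #V < κ) {B : Set Y} (hB : #B < κ) {𝒳 : Set (Set (V → Y))}
    (hdef : ∀ X ∈ 𝒳, B.Definable L X) (hfip : FIP 𝒳) : ∃ a, ∀ X ∈ 𝒳, a ∈ X := by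
  -- In the ultrapower along `U`, the coordinate functions form a tuple satisfying all the given
  -- conditions. Extending the identity on `B` to these coordinates carries the tuple into `Y`.
  obtain ⟨U, hU⟩ := hfip.exists_ultrafilter
  have h0 : ElemRel L (Set.range fun b : B => (Ultrapower.mk U fun _ => (b : Y), (b : Y))) :=
    elemRel_range (Ultrapower.eqType_const U _)
  obtain ⟨R, hR, hel, hdom⟩ := h0.exists_extend hY hκ (Cardinal.mk_range_le.trans_lt hB)
    (Set.range fun i : V => Ultrapower.mk U fun f => f i) (Cardinal.mk_range_le.trans_lt hV)
  choose y hy using fun i : V => hdom _ ⟨i, rfl⟩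
  refine ⟨y, fun X hX => ?_⟩
  obtain ⟨φ, rfl⟩ := Set.definable_iff_exists_formula_sum.1 (hdef X hX)
  have key := hel.eqType (f := fun i => Ultrapower.mk U
    (Sum.elim (fun (b : B) _ => (b : Y)) (fun (i : V) (f : V → Y) => f i) i))
    (g := Sum.elim (fun b : B => (b : Y)) y) (by
      rintro (b | i)
      · exact hR ⟨b, rfl⟩
      · exact hy i)
  refine (key φ).1 ((Ultrapower.realize_mk U φ _).2 ?_)
  convert hU _ hX using 4 with f
  funext i
  rcases i with i | i <;> rfl

end Ultrapower

/-! ### Saturated structures of size `κ` are strongly homogeneous -/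

section Homogeneous

variable {L : FirstOrder.Language.{u, v}} {A : Type w} [L.Structure A] {κ : Cardinal.{w}}

theorem ElemRel.exists_equiv {R : Set (A × A)} (h : ElemRel L R) (h1 : ∀ x, ∃ y, (x, y) ∈ R)
    (h2 : ∀ y, ∃ x, (x, y) ∈ R) : ∃ σ : A ≃[L] A, ∀ r ∈ R, σ r.1 = r.2 := by
  choose f hf using h1
  choose g hg using h2
  have huniq : ∀ r ∈ R, ∀ r' ∈ R, r.1 = r'.1 ↔ r.2 = r'.2 := fun r hr r' hr' =>
    h.eq_iff ⟨r, hr⟩ ⟨r', hr'⟩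
  let σ : A ≃ A :=
    { toFun := f
      invFun := g
      left_inv := fun x => (huniq _ (hg (f x)) _ (hf x)).2 rfl
      right_inv := fun y => (huniq _ (hf (g y)) _ (hg y)).1 rfl }
  have hσ : EqType L (id : A → A) σ := h.eqType hf
  refine ⟨{ σ with map_fun' := ?_, map_rel' := ?_ }, fun r hr => ?_⟩
  · intro n F x
    have := hσ ((Term.func F fun i => Term.var (x i)).equal
      (Term.var (Structure.funMap F x)))
    simp only [Formula.realize_equal, Term.realize_func, Term.realize_var] at this
    exact (this.1 rfl).symm
  · intro n r x
    have := hσ (r.formula fun i => Term.var (x i))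
    simp only [Formula.realize_rel, Term.realize_var] at this
    exact this.symm
  · exact (huniq _ (hf r.1) _ hr).1 rfl

/-- Back and forth along an enumeration of `A` in order type `κ`. A stage adds at most two pairs, so
the relation built before any stage has size below `κ` and saturation still applies. -/
theorem IsSaturated.isStronglyHomogeneous (hA : IsSaturated L κ A) (hκ : ℵ₀ < κ)
    (hcard : #A = κ) : IsStronglyHomogeneous L κ A := by
  classical
  intro B hB f hf
  let R₀ : Set (A × A) := Set.range fun b : B => ((b : A), f b)
  have hR₀ : ElemRel L R₀ := elemRel_range hf
  have hR₀c : #R₀ < κ := Cardinal.mk_range_le.trans_lt hB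
  obtain ⟨e⟩ : Nonempty (κ.ord.ToType ≃ A) := by
    rw [← Cardinal.eq, Cardinal.mk_ord_toType, hcard]
  -- One stage puts `e j` into both the domain and the range. The default `∅` does not occur for
  -- elementary relations of size below `κ`.
  let step : κ.ord.ToType → Set (A × A) → Set (A × A) := fun j R =>
    if h : ∃ x y, ElemRel L (insert (x, e j) (insert (e j, y) R)) then
      {(h.choose, e j), (e j, h.choose_spec.choose)} else ∅
  let g : κ.ord.ToType → Set (A × A) := wellFounded_lt.fix fun j G =>
    step j (R₀ ∪ ⋃ i, ⋃ h : i < j, G i h)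
  have hg : ∀ j, g j = step j (R₀ ∪ ⋃ i, ⋃ _ : i < j, g i) := fun j =>
    wellFounded_lt.fix_eq _ j
  have hstep : ∀ j R, ElemRel L R → #R < κ →
      ElemRel L (R ∪ step j R) ∧ (∃ x, (x, e j) ∈ step j R) ∧ ∃ y, (e j, y) ∈ step j R := by
    intro j R hR hc
    have hex : ∃ x y, ElemRel L (insert (x, e j) (insert (e j, y) R)) := by
      obtain ⟨y, hy⟩ := hR.exists_insert hA hc (e j)
      have hc' : #(Prod.swap '' (insert (e j, y) R) : Set (A × A)) < κ :=
        Cardinal.mk_image_le.trans_lt (Cardinal.mk_insert_le.trans_lt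
          (Cardinal.add_lt_of_lt hκ.le hc (Cardinal.one_lt_aleph0.trans hκ)))
      obtain ⟨x, hx⟩ := hy.image_swap.exists_insert hA hc' (e j)
      refine ⟨x, y, ?_⟩
      have := hx.image_swap
      rwa [Set.image_insert_eq, ← Set.image_comp, Prod.swap_swap_eq, Set.image_id] at this
    simp only [step, dif_pos hex]
    refine ⟨hex.choose_spec.choose_spec.mono ?_, ⟨_, Set.mem_insert _ _⟩,
      ⟨_, Set.mem_insert_of_mem _ rfl⟩⟩
    rintro r (hr | rfl | rfl)
    · exact Set.mem_insert_of_mem _ (Set.mem_insert_of_mem _ hr)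
    · exact Set.mem_insert _ _
    · exact Set.mem_insert_of_mem _ (Set.mem_insert _ _)
  have hgc : ∀ j, #(g j) ≤ ℵ₀ := by
    intro j
    rw [hg, Cardinal.mk_le_aleph0_iff, Set.countable_coe_iff]
    simp only [step]
    split_ifs
    · exact (Set.toFinite _).countable
    · exact Set.countable_empty
  have hcard' : ∀ j, #(R₀ ∪ ⋃ i, ⋃ _ : i < j, g i : Set (A × A)) < κ := by
    intro j
    refine (Cardinal.mk_union_le _ _).trans_lt (Cardinal.add_lt_of_lt hκ.le hR₀c ?_)
    have : (⋃ i, ⋃ _ : i < j, g i) = ⋃ i : Set.Iio j, g i := by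
      ext; simp
    rw [this]
    refine Cardinal.mk_iUnion_le_sum_mk.trans_lt ((Cardinal.sum_le_sum _ (fun _ => ℵ₀)
      fun i : Set.Iio j => hgc i).trans_lt ?_)
    rw [Cardinal.sum_const']
    exact Cardinal.mul_lt_of_lt hκ.le (by simpa using Cardinal.mk_Iio_lt j) hκ
  have hunion : ∀ s : Set κ.ord.ToType, (∀ j ∈ s, ElemRel L (R₀ ∪ ⋃ i, ⋃ _ : i ≤ j, g i)) →
      ElemRel L (R₀ ∪ ⋃ i, ⋃ _ : i ∈ s, g i) := by
    intro s hs
    have := ElemRel.sUnion (C := insert R₀ ((fun j => R₀ ∪ ⋃ i, ⋃ _ : i ≤ j, g i) '' s)) (by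
        rintro R (rfl | ⟨j, hj, rfl⟩)
        · exact hR₀
        · exact hs j hj) (by
        refine IsChain.directedOn ?_
        refine IsChain.insert ?_ ?_
        · refine Monotone.isChain_image ?_ (fun i _ j _ _ => le_total i j)
          intro i j hij
          refine Set.union_subset_union_right _ (Set.iUnion_mono fun k =>
            Set.iUnion_mono' fun h => ⟨h.trans hij, subset_rfl⟩)
        · rintro R ⟨j, hj, rfl⟩ -
          exact Or.inl Set.subset_union_left) ⟨_, Set.mem_insert _ _⟩
    refine this.mono ?_
    rintro r (hr | hr)
    · exact ⟨R₀, Set.mem_insert _ _, hr⟩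
    · simp only [Set.mem_iUnion] at hr
      obtain ⟨j, hj, hr⟩ := hr
      refine ⟨_, Set.mem_insert_of_mem _ ⟨j, hj, rfl⟩, Or.inr ?_⟩
      simp only [Set.mem_iUnion]
      exact ⟨j, le_rfl, hr⟩
  have hel : ∀ j, ElemRel L (R₀ ∪ ⋃ i, ⋃ _ : i ≤ j, g i) := by
    intro j
    induction j using WellFoundedLT.induction with
    | ind j ih =>
      have h1 := hunion (Set.Iio j) ih
      refine (hstep j _ h1 (hcard' j)).1.mono ?_
      rintro r (hr | hr)
      · exact Or.inl (Or.inl hr)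
      · simp only [Set.mem_iUnion] at hr
        obtain ⟨i, hi, hr⟩ := hr
        rcases hi.lt_or_eq with hi | rfl
        · refine Or.inl (Or.inr ?_)
          simp only [Set.mem_iUnion]
          exact ⟨i, hi, hr⟩
        · rw [hg] at hr
          exact Or.inr hr
  have hfull := hunion Set.univ fun j _ => hel j
  have htot : ∀ a, (∃ x, (x, a) ∈ R₀ ∪ ⋃ i, ⋃ _ : i ∈ Set.univ, g i) ∧
      ∃ y, (a, y) ∈ R₀ ∪ ⋃ i, ⋃ _ : i ∈ Set.univ, g i := by
    intro a
    obtain ⟨j, rfl⟩ := e.surjective a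
    have h1 := hstep j _ (hunion (Set.Iio j) fun i _ => hel i) (hcard' j)
    have h2 : ∀ r ∈ g j, r ∈ R₀ ∪ ⋃ i, ⋃ _ : i ∈ Set.univ, g i := fun r hr => Or.inr (by
      simp only [Set.mem_iUnion]
      exact ⟨j, trivial, hr⟩)
    obtain ⟨-, ⟨x, hx⟩, ⟨y, hy⟩⟩ := h1
    exact ⟨⟨x, h2 _ ((hg j).symm ▸ hx)⟩, ⟨y, h2 _ ((hg j).symm ▸ hy)⟩⟩
  obtain ⟨σ, hσ⟩ := hfull.exists_equiv (fun a => (htot a).2) fun a => (htot a).1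
  exact ⟨σ, fun b => hσ _ (Or.inl ⟨b, rfl⟩)⟩

end Homogeneous

/-! ### Transfinite acceptance and counting of tasks -/

section Greedy

/-- Running along a well-order and accepting each family of sets which has the finite intersection
property together with the families accepted before. -/
theorem exists_greedy {C W : Type*} [LinearOrder C] [WellFoundedLT C] [Nonempty W]
    (E : C → Set (Set W)) : ∃ acc : Set C, FIP (⋃ c ∈ acc, E c) ∧
      ∀ c, FIP ((⋃ c' ∈ {c' ∈ acc | c' < c}, E c') ∪ E c) → c ∈ acc := by
  classical
  let acc : C → Prop := wellFounded_lt.fix fun c G =>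
    FIP ((⋃ c' ∈ {c' : C | ∃ h : c' < c, G c' h}, E c') ∪ E c)
  have hacc : ∀ c, acc c ↔ FIP ((⋃ c' ∈ {c' : C | acc c' ∧ c' < c}, E c') ∪ E c) := by
    intro c
    have : acc c = FIP ((⋃ c' ∈ {c' : C | ∃ h : c' < c, acc c'}, E c') ∪ E c) :=
      wellFounded_lt.fix_eq _ c
    rw [this]
    have h2 : {c' : C | ∃ h : c' < c, acc c'} = {c' : C | acc c' ∧ c' < c} := by
      ext c'
      simp [and_comm]
    rw [h2]
  refine ⟨{c | acc c}, fun t ht hfin => ?_, fun c hc => (hacc c).2 hc⟩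
  rcases t.eq_empty_or_nonempty with rfl | ⟨X, hX⟩
  · simp
  have hmono : ∀ c c', c ≤ c' → acc c' → acc c →
      (⋃ d ∈ {d : C | acc d ∧ d < c}, E d) ∪ E c ⊆
      (⋃ d ∈ {d : C | acc d ∧ d < c'}, E d) ∪ E c' := by
    rintro c c' hcc h' h
    rcases hcc.lt_or_eq with hcc | rfl
    · refine Set.union_subset ?_ ?_
      · refine Set.Subset.trans ?_ Set.subset_union_left
        exact Set.biUnion_subset_biUnion_left fun d hd => ⟨hd.1, hd.2.trans hcc⟩
      · refine Set.Subset.trans ?_ Set.subset_union_left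
        exact Set.subset_biUnion_of_mem (u := E) (show c ∈ {d | acc d ∧ d < c'} from ⟨h, hcc⟩)
    · exact subset_rfl
  have hne : {c | acc c}.Nonempty := by
    obtain ⟨_, ⟨c, rfl⟩, h⟩ := ht hX
    simp only [Set.mem_iUnion] at h
    exact ⟨c, h.1⟩
  -- A finite subfamily already occurs at or below one accepted index, whose acceptance is exactly
  -- its finite intersection property.
  obtain ⟨c, hc, hsub⟩ := DirectedOn.exists_mem_subset_of_finset_subset_biUnion
    (f := fun c => (⋃ d ∈ {d : C | acc d ∧ d < c}, E d) ∪ E c) (c := {c | acc c}) hne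
    (by
      intro c hc c' hc'
      rcases le_total c c' with h | h
      · exact ⟨c', hc', hmono c c' h hc' hc, subset_rfl⟩
      · exact ⟨c, hc, subset_rfl, hmono c' c h hc hc'⟩) (s := hfin.toFinset) (by
      rw [hfin.coe_toFinset]
      refine ht.trans (Set.iUnion₂_mono fun c _ => Set.subset_union_right))
  rw [hfin.coe_toFinset] at hsub
  exact (hacc c).1 hc t hsub hfin

end Greedy

section Cardinality

variable {L : FirstOrder.Language.{u, v}} {μ : Cardinal.{w}}

theorem mk_formula_le {I : Type w} (hμ : ℵ₀ ≤ μ) (hI : #I ≤ μ)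
    (hL : Cardinal.lift.{w} L.card ≤ Cardinal.lift.{max u v} μ) :
    #(L.Formula I) ≤ Cardinal.lift.{max u v} μ := by
  have h1 : #(L.Formula I) ≤ #(Σ n, L.BoundedFormula I n) :=
    Cardinal.mk_le_of_injective (f := fun φ : L.Formula I => (⟨0, φ⟩ : Σ n, L.BoundedFormula I n))
      fun φ ψ h => by simpa using h
  refine h1.trans (BoundedFormula.card_le.trans (max_le (by simpa using hμ) ?_))
  exact Cardinal.add_le_of_le (by simpa using hμ) (Cardinal.lift_le.2 hI) hL

/-- König: raising `2 ^ μ` to its cofinality gives something larger, whereas `(2 ^ μ) ^ μ = 2 ^ μ`.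
-/
theorem lt_cof_two_power (hμ : ℵ₀ ≤ μ) : μ < ((2 : Cardinal.{w}) ^ μ).ord.cof := by
  by_contra hn
  have h2 : ℵ₀ ≤ (2 : Cardinal.{w}) ^ μ := hμ.trans (Cardinal.cantor μ).le
  have h3 := Cardinal.lt_power_cof_ord h2
  refine h3.not_ge ((Cardinal.power_le_power_left (Cardinal.aleph0_pos.trans_le h2).ne' (not_lt.1 hn)).trans ?_)
  rw [← Cardinal.power_mul, Cardinal.mul_eq_self hμ]

/-- An enumeration of a set of size `2 ^ μ` in which each element occurs cofinally often. -/
theorem exists_cofinal_enumeration {D : Type*} [Nonempty D] {ν : Cardinal.{w}} (hν : ℵ₀ ≤ ν)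
    (hD : Nonempty (D ↪ ν.ord.ToType)) :
    ∃ e : ν.ord.ToType → D, ∀ d c₀, ∃ c, c₀ < c ∧ e c = d := by
  obtain ⟨j⟩ := hD
  obtain ⟨p⟩ : Nonempty (ν.ord.ToType ≃ ν.ord.ToType × ν.ord.ToType) := by
    rw [← Cardinal.eq, Cardinal.mk_prod, Cardinal.lift_id, Cardinal.mk_ord_toType,
      Cardinal.mul_eq_self hν]
  refine ⟨fun c => Function.invFun j (p c).2, fun d c₀ => ?_⟩
  by_contra! hn
  have h1 : #(Set.Iic c₀) < ν := by
    rw [← Set.Iio_union_right]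
    refine (Cardinal.mk_union_le _ _).trans_lt (Cardinal.add_lt_of_lt hν
      (by simpa using Cardinal.mk_Iio_lt c₀) ?_)
    rw [Cardinal.mk_singleton]
    exact Cardinal.one_lt_aleph0.trans_le hν
  have h2 : ν ≤ #(Set.Iic c₀) := by
    refine (Cardinal.mk_ord_toType ν).symm.le.trans ?_
    refine Cardinal.mk_le_of_injective (f := fun c : ν.ord.ToType =>
      (⟨p.symm (c, j d), ?_⟩ : Set.Iic c₀)) ?_
    · by_contra hlt
      exact hn _ (not_le.1 hlt) (by simp [Function.leftInverse_invFun j.injective d])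
    · intro c c' h
      simpa using h
  exact h1.not_ge h2

/-- A code is a task: `μ` parameters, each an element of `A` or a new constant, and a set of
formulas to be realized over them. There are few enough tasks to be listed along `2 ^ μ` stages. -/
theorem nonempty_embedding_codes {A : Type w} (hμ : ℵ₀ ≤ μ) (hA : #A ≤ 2 ^ μ)
    (hL : Cardinal.lift.{w} L.card ≤ Cardinal.lift.{max u v} μ) :
    Nonempty ((μ.out → A ⊕ ((2 : Cardinal.{w}) ^ μ).ord.ToType) ×
      Set (L.Formula (μ.out ⊕ Fin 1)) ↪ ((2 : Cardinal.{w}) ^ μ).ord.ToType) := by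
  have h2 : ℵ₀ ≤ (2 : Cardinal.{w}) ^ μ := hμ.trans (Cardinal.cantor μ).le
  rw [← Cardinal.lift_mk_le'.{max u v w, w}, Cardinal.mk_prod, Cardinal.mk_ord_toType]
  simp only [Cardinal.lift_mul, Cardinal.lift_lift]
  refine Cardinal.mul_le_of_le (Cardinal.aleph0_le_lift.2 h2) ?_ ?_
  · have : #(μ.out → A ⊕ ((2 : Cardinal.{w}) ^ μ).ord.ToType) ≤ 2 ^ μ := by
      rw [← Cardinal.power_def, Cardinal.mk_sum, Cardinal.mk_out, Cardinal.lift_id,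
        Cardinal.lift_id, Cardinal.mk_ord_toType]
      refine (Cardinal.power_le_power_right (Cardinal.add_le_of_le h2 hA le_rfl)).trans ?_
      rw [← Cardinal.power_mul, Cardinal.mul_eq_self hμ]
    simpa using Cardinal.lift_le.{max u v w}.2 this
  · rw [Cardinal.mk_set, Cardinal.lift_two_power, Cardinal.lift_two_power]
    refine Cardinal.power_le_power_left two_ne_zero ?_
    have h1 : #(μ.out ⊕ Fin 1) ≤ μ := by
      rw [Cardinal.mk_sum, Cardinal.mk_out]
      refine Cardinal.add_le_of_le hμ (by simp) ?_
      simpa using Cardinal.one_le_aleph0.trans hμ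
    have := mk_formula_le (L := L) (I := μ.out ⊕ Fin 1) hμ h1 hL
    simpa using Cardinal.lift_le.{w}.2 this

end Cardinality

/-! ### Saturated elementary extensions of size at most `2 ^ μ` -/

section SaturatedExtension

variable {L : FirstOrder.Language.{u, v}}

theorem exists_elementarySubstructure_coe_eq {X : Type w} [L.Structure X] (S : Set X)
    (h : ∀ B : Finset X, (B : Set X) ⊆ S → ∀ φ : L.Formula (B ⊕ Fin 1),
      (∃ x, φ.Realize (Sum.elim (fun b : B => (b : X)) fun _ => x)) →
      ∃ x ∈ S, φ.Realize (Sum.elim (fun b : B => (b : X)) fun _ => x)) :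
    ∃ T : L.ElementarySubstructure X, (T : Set X) = S := by
  have hS : L.MeetsDefinable S := by
    intro D ⟨x, hx⟩ hD
    obtain ⟨B, hB, hD⟩ := Set.definable_iff_finitely_definable.1 hD
    obtain ⟨φ, hφ⟩ := Set.definable_iff_exists_formula_sum.1 hD
    have key : ∀ x, x ∈ D ↔ φ.Realize (Sum.elim (fun b : B => (b : X)) fun _ => x) := by
      intro x
      exact iff_of_eq (congrArg (fun Z : Set (Fin 1 → X) => (fun _ => x) ∈ Z) hφ)
    obtain ⟨y, hy, hy'⟩ := h B hB φ ⟨x, (key x).1 hx⟩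
    exact ⟨y, (key y).2 hy', hy⟩
  exact ⟨hS.toElementarySubstructure, hS.closure_eq_self⟩

/-- A single ultrapower replaces a chain of extensions. The index set is `C → A`, so each `c : C`
gives an element of the ultrapower, evaluation at `c`. The ultrafilter is chosen so that these
evaluations, together with `A`, form a saturated elementary substructure. -/
theorem exists_saturated_extension {A : Type w} [L.Structure A] [Nonempty A] {μ : Cardinal.{w}}
    (hμ : ℵ₀ ≤ μ) (hA : #A ≤ 2 ^ μ)
    (hL : Cardinal.lift.{w} L.card ≤ Cardinal.lift.{max u v} μ) :
    ∃ (S : Type w) (_ : L.Structure S), #S ≤ 2 ^ μ ∧ IsSaturated L (Order.succ μ) S ∧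
      Nonempty (A ↪ₑ[L] S) := by
  classical
  have hν : ℵ₀ ≤ (2 : Cardinal.{w}) ^ μ := hμ.trans (Cardinal.cantor μ).le
  let C := ((2 : Cardinal.{w}) ^ μ).ord.ToType
  have hC : #C = 2 ^ μ := Cardinal.mk_ord_toType _
  have hCne : Nonempty C := by
    rw [← Cardinal.mk_ne_zero_iff, hC]
    exact (Cardinal.aleph0_pos.trans_le hν).ne'
  obtain ⟨e, he⟩ := exists_cofinal_enumeration (D := (μ.out → A ⊕ C) ×
      Set (L.Formula (μ.out ⊕ Fin 1))) hν (nonempty_embedding_codes hμ hA hL)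
  -- the condition on `f : C → A` that the constant `c` realizes `φ` with parameters `b`
  let cond : C → (μ.out → A ⊕ C) → L.Formula (μ.out ⊕ Fin 1) → Set (C → A) := fun c b φ =>
    {f | φ.Realize (Sum.elim (fun i => Sum.elim id f (b i)) fun _ => f c)}
  let fresh : C → (μ.out → A ⊕ C) → Prop := fun c b => ∀ i c', b i = Sum.inr c' → c' < c
  let E : C → Set (Set (C → A)) := fun c =>
    {X | fresh c (e c).1 ∧ ∃ φ ∈ (e c).2, X = cond c (e c).1 φ}
  obtain ⟨acc, hfip, hacc⟩ := exists_greedy E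
  obtain ⟨U, hU⟩ := hfip.exists_ultrafilter
  let v : A ⊕ C → Ultrapower U A := fun k => Ultrapower.mk U fun f => Sum.elim id f k
  have hUacc : ∀ c ∈ acc, ∀ X ∈ E c, X ∈ U := fun c hc X hX =>
    hU X (Set.mem_biUnion hc hX)
  -- the ultrapower realizes types over constants by constants
  have claim : ∀ (b : μ.out → A ⊕ C) (Γ : Set (L.Formula (μ.out ⊕ Fin 1))),
      (∀ Γ₀ : Finset (L.Formula (μ.out ⊕ Fin 1)), (Γ₀ : Set _) ⊆ Γ →
        ∃ x, ∀ φ ∈ Γ₀, φ.Realize (Sum.elim (v ∘ b) fun _ => x)) →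
      ∃ c, ∀ φ ∈ Γ, φ.Realize (Sum.elim (v ∘ b) fun _ => v (Sum.inr c)) := by
    intro b Γ hΓ
    -- At most `μ` new constants occur in `b`, and `μ` is below the cofinality of `C`. Each task
    -- recurs cofinally, so it is listed at a stage beyond all its parameters.
    obtain ⟨c₀, hc₀⟩ : ∃ c₀ : C, ∀ i c', b i = Sum.inr c' → c' < c₀ := by
      have hlt : #(Sum.inr ⁻¹' Set.range b : Set C) < Order.cof C := by
        rw [Ordinal.cof_toType]
        refine lt_of_le_of_lt ?_ (lt_cof_two_power hμ)
        refine (Cardinal.mk_preimage_of_injective _ _ Sum.inr_injective).trans ?_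
        exact Cardinal.mk_range_le.trans (Cardinal.mk_out μ).le
      have hnot : ¬ IsCofinal (Sum.inr ⁻¹' Set.range b : Set C) := fun h =>
        (Order.cof_le h).not_gt hlt
      obtain ⟨c₀, h⟩ := not_isCofinal_iff.1 hnot
      exact ⟨c₀, fun i c' hi => h c' ⟨i, hi⟩⟩
    obtain ⟨c, hc, hec⟩ := he (b, Γ) c₀
    have hfresh : fresh c b := fun i c' hi => (hc₀ i c' hi).trans hc
    have hcacc : c ∈ acc := by
      refine hacc c fun t ht hfin => ?_
      -- the formulas of `Γ` involved in `t`
      obtain ⟨Γ₀, hΓ₀, htΓ⟩ : ∃ Γ₀ : Finset (L.Formula (μ.out ⊕ Fin 1)), (Γ₀ : Set _) ⊆ Γ ∧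
          ∀ X ∈ t, (∃ c' ∈ acc, c' < c ∧ X ∈ E c') ∨ ∃ φ ∈ Γ₀, X = cond c b φ := by
        have hE : t \ (⋃ c' ∈ {c' ∈ acc | c' < c}, E c') ⊆ cond c b '' Γ := by
          rintro X ⟨hX, hX'⟩
          obtain ⟨-, φ, hφ, rfl⟩ := (ht hX).resolve_left hX'
          rw [hec] at hφ ⊢
          exact ⟨φ, hφ, rfl⟩
        obtain ⟨Γ₀, h1, h2⟩ := Finset.subset_set_image_iff.1
          (show ((hfin.subset Set.sdiff_subset).toFinset : Set (Set (C → A))) ⊆ cond c b '' Γ by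
            rw [Set.Finite.coe_toFinset]; exact hE)
        refine ⟨Γ₀, h1, fun X hX => ?_⟩
        by_cases hX' : X ∈ ⋃ c' ∈ {c' ∈ acc | c' < c}, E c'
        · left
          simp only [Set.mem_iUnion] at hX'
          obtain ⟨c', hc', h⟩ := hX'
          exact ⟨c', hc'.1, hc'.2, h⟩
        · right
          have : X ∈ Γ₀.image (cond c b) := by
            rw [h2, Set.Finite.mem_toFinset]
            exact ⟨hX, hX'⟩
          obtain ⟨φ, hφ, rfl⟩ := Finset.mem_image.1 this
          exact ⟨φ, hφ, rfl⟩
      obtain ⟨ψ, hψ, hψ'⟩ := exists_conj (X := A) (Y := Ultrapower U A) Γ₀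
      have h1 : {f : C → A | ∃ x, ψ.Realize (Sum.elim (fun i => Sum.elim id f (b i))
          fun _ => x)} ∈ U := by
        obtain ⟨x, hx⟩ := hΓ Γ₀ hΓ₀
        have h2 : (ψ.iExs (Fin 1)).Realize (fun i => v (b i)) :=
          Formula.realize_iExs.2 ⟨fun _ => x, (hψ' _).2 hx⟩
        rw [Ultrapower.realize_mk] at h2
        filter_upwards [h2] with f hf
        obtain ⟨x, hx⟩ := Formula.realize_iExs.1 hf
        refine ⟨x 0, ?_⟩
        convert hx using 2
        funext i
        rw [Subsingleton.elim i 0]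
      have h2 : ∀ᶠ f in (U : Filter (C → A)), ∀ X ∈ t, (∃ c' ∈ acc, c' < c ∧ X ∈ E c') → f ∈ X := by
        rw [Filter.eventually_all_finite hfin]
        intro X _
        by_cases h : ∃ c' ∈ acc, c' < c ∧ X ∈ E c'
        · obtain ⟨c', hc', -, hX⟩ := h
          filter_upwards [hUacc c' hc' X hX] with f hf _ using hf
        · exact Filter.Eventually.of_forall fun f hf => absurd hf h
      obtain ⟨f, ⟨x, hx⟩, hf⟩ := U.nonempty_of_mem (Filter.inter_mem h1 h2)
      -- Conditions accepted before `c` mention only coordinates below `c`, and the parameters of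
      -- the new task are below `c` too. Changing `f` at `c` alone therefore keeps the former and
      -- meets the latter.
      refine ⟨Function.update f c x, fun X hX => ?_⟩
      have hupd : ∀ (c' : C) (b' : μ.out → A ⊕ C), (∀ i d, b' i = Sum.inr d → d ≠ c) →
          (fun i => Sum.elim id (Function.update f c x) (b' i)) =
            fun i => Sum.elim id f (b' i) := by
        intro c' b' hb'
        funext i
        rcases hbi : b' i with a | d
        · rfl
        · simp [Function.update_of_ne (hb' i d hbi)]
      rcases htΓ X hX with ⟨c', hc', hlt, hXE⟩ | ⟨φ, hφ, rfl⟩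
      · have hfX := hf X hX ⟨c', hc', hlt, hXE⟩
        obtain ⟨hfr, φ, hφ, rfl⟩ := hXE
        simp only [cond, Set.mem_ofPred_eq] at hfX ⊢
        rw [hupd c' _ fun i d hd => ((hfr i d hd).trans hlt).ne, Function.update_of_ne hlt.ne]
        exact hfX
      · simp only [cond, Set.mem_ofPred_eq]
        rw [hupd c _ fun i d hd => (hfresh i d hd).ne, Function.update_self]
        exact (hψ _).1 hx φ hφ
    refine ⟨c, fun φ hφ => ?_⟩
    have hmem : cond c b φ ∈ U := hUacc c hcacc _ ⟨by rw [hec]; exact hfresh, φ, by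
      rw [hec]; exact ⟨hφ, rfl⟩⟩
    have := (Ultrapower.realize_mk U φ
      (Sum.elim (fun i f => Sum.elim id f (b i)) fun _ f => f c)).2 (by
        convert hmem using 1
        ext f
        simp only [cond, Set.mem_ofPred_eq]
        refine iff_of_eq (congrArg _ ?_)
        funext i
        rcases i with i | i <;> rfl)
    convert this using 1
    funext i
    rcases i with i | i <;> rfl
  -- For finite `I` and one formula this is the Tarski-Vaught test for the range of `v`; in general
  -- it is the saturation of that range.
  have claim2 : ∀ (I : Type w) (_ : #I ≤ μ) (b : I → Ultrapower U A) (_ : ∀ i, b i ∈ Set.range v)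
      (Γ : Set (L.Formula (I ⊕ Fin 1))),
      (∀ Γ₀ : Finset (L.Formula (I ⊕ Fin 1)), (Γ₀ : Set _) ⊆ Γ →
        ∃ x, ∀ φ ∈ Γ₀, φ.Realize (Sum.elim b fun _ => x)) →
      ∃ y ∈ Set.range v, ∀ φ ∈ Γ, φ.Realize (Sum.elim b fun _ => y) := by
    intro I hI b hb Γ hΓ
    obtain ⟨j⟩ : Nonempty (I ↪ μ.out) := by
      rw [← Cardinal.le_def, Cardinal.mk_out]
      exact hI
    choose k hk using hb
    let b' : μ.out → A ⊕ C := Function.extend j k fun _ => Sum.inr (Classical.arbitrary C)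
    have hb' : ∀ i, v (b' (j i)) = b i := fun i => by
      simp only [b', j.injective.extend_apply, hk]
    let conv : L.Formula (I ⊕ Fin 1) → L.Formula (μ.out ⊕ Fin 1) :=
      Formula.relabel (Sum.map j id)
    have hconv : ∀ φ x, (conv φ).Realize (Sum.elim (v ∘ b') fun _ => x) ↔
        φ.Realize (Sum.elim b fun _ => x) := by
      intro φ x
      rw [Formula.realize_relabel]
      refine iff_of_eq (congrArg _ ?_)
      funext i
      rcases i with i | i
      · exact hb' i
      · rfl
    obtain ⟨c, hc⟩ := claim b' (conv '' Γ) (by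
      intro Γ₀ h₀
      obtain ⟨Γ₁, h₁, rfl⟩ := Finset.subset_set_image_iff.1 h₀
      obtain ⟨x, hx⟩ := hΓ Γ₁ h₁
      refine ⟨x, fun φ hφ => ?_⟩
      obtain ⟨ψ, hψ, rfl⟩ := Finset.mem_image.1 hφ
      exact (hconv _ _).2 (hx ψ hψ))
    exact ⟨_, ⟨_, rfl⟩, fun φ hφ => (hconv _ _).1 (hc _ ⟨φ, hφ, rfl⟩)⟩
  obtain ⟨S, hS⟩ := exists_elementarySubstructure_coe_eq (L := L) (Set.range v) (by
    intro B hB φ hφ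
    obtain ⟨y, hy, h⟩ := claim2 B ((Cardinal.lt_aleph0_of_finite B).le.trans hμ) _
      (fun b => hB b.2) {φ} (fun Γ₀ h₀ => by
        obtain ⟨x, hx⟩ := hφ
        refine ⟨x, fun ψ hψ => ?_⟩
        rw [Set.mem_singleton_iff.1 (h₀ hψ)]
        exact hx)
    exact ⟨y, hy, h φ rfl⟩)
  have hmemS : ∀ x, x ∈ S ↔ x ∈ Set.range v := fun x => by rw [← hS]; rfl
  refine ⟨S, inferInstance, ?_, ?_, ?_⟩
  · have : #S = #(Set.range v) := by rw [← hS]; rfl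
    rw [this]
    refine Cardinal.mk_range_le.trans ?_
    rw [Cardinal.mk_sum, Cardinal.lift_id, Cardinal.lift_id, hC]
    exact Cardinal.add_le_of_le hν hA le_rfl
  · refine IsSaturated.of_exists_realize fun B hB Γ hΓ => ?_
    have htrans : ∀ (φ : L.Formula (B ⊕ Fin 1)) (x : S),
        φ.Realize (Sum.elim (fun b : B => ((b : S) : Ultrapower U A)) fun _ => (x : Ultrapower U A)) ↔
        φ.Realize (Sum.elim (fun b : B => (b : S)) fun _ => x) := by
      intro φ x
      rw [← S.subtype.map_formula]
      refine iff_of_eq (congrArg _ ?_)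
      funext i
      rcases i with i | i <;> rfl
    obtain ⟨y, hy, h⟩ := claim2 B (Order.lt_succ_iff.1 hB) (fun b => ((b : S) : Ultrapower U A))
      (fun b => (hmemS _).1 (b : S).2) Γ (fun Γ₀ h₀ => by
        obtain ⟨x, hx⟩ := hΓ Γ₀ h₀
        exact ⟨x, fun φ hφ => (htrans _ _).2 (hx φ hφ)⟩)
    exact ⟨⟨y, (hmemS y).2 hy⟩, fun φ hφ => (htrans φ ⟨y, (hmemS y).2 hy⟩).1 (h φ hφ)⟩
  · refine ⟨⟨fun a => ⟨v (Sum.inl a), (hmemS _).2 ⟨_, rfl⟩⟩, fun n φ x => ?_⟩⟩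
    rw [← S.subtype.map_formula]
    exact Ultrapower.eqType_const U x φ

end SaturatedExtension

/-! ### Embedding small models into a saturated one -/

section Embedding

variable {L : FirstOrder.Language.{u, v}} {X Y : Type w} [L.Structure X] [L.Structure Y]
  {κ : Cardinal.{w}}

theorem EqType.map_fun {g : X → Y} (h : EqType L (id : X → X) g) {n : ℕ} (F : L.Functions n)
    (x : Fin n → X) : g (Structure.funMap F x) = Structure.funMap F (g ∘ x) := by
  have := h ((Term.func F fun i => Term.var (x i)).equal (Term.var (Structure.funMap F x)))
  simp only [Formula.realize_equal, Term.realize_func, Term.realize_var] at this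
  exact (this.1 rfl).symm

theorem EqType.map_rel {g : X → Y} (h : EqType L (id : X → X) g) {n : ℕ} (r : L.Relations n)
    (x : Fin n → X) : Structure.RelMap r (g ∘ x) ↔ Structure.RelMap r x := by
  have := h (r.formula fun i => Term.var (x i))
  simp only [Formula.realize_rel, Term.realize_var] at this
  exact this.symm

theorem IsSaturated.of_eqType (hX : IsSaturated L κ X) {g : X → Y}
    (hg : EqType L (id : X → X) g) (hsurj : Function.Surjective g) : IsSaturated L κ Y := by
  refine IsSaturated.of_exists_realize fun B hB Γ hΓ => ?_
  choose k hk using hsurj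
  have hcomp : ∀ (φ : L.Formula (B ⊕ Fin 1)) (x : X),
      φ.Realize (Sum.elim (fun b : B => k b) fun _ => x) ↔
        φ.Realize (Sum.elim (fun b : B => (b : Y)) fun _ => g x) := by
    intro φ x
    refine (hg.comp _ φ).trans (iff_of_eq (congrArg _ ?_))
    funext i
    rcases i with i | i
    · exact hk i
    · rfl
  obtain ⟨x, hx⟩ := hX.exists_realize hB (fun b : B => k b) Γ (fun Γ₀ h₀ => by
    obtain ⟨a, ha⟩ := hΓ Γ₀ h₀
    refine ⟨k a, fun φ hφ => (hcomp _ _).2 ?_⟩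
    rw [hk]
    exact ha φ hφ)
  exact ⟨g x, fun φ hφ => (hcomp _ _).1 (hx φ hφ)⟩

theorem EqType.exists_range {g : X → Y} (hg : EqType L (id : X → X) g) :
    ∃ T : L.ElementarySubstructure Y, (T : Set Y) = Set.range g := by
  refine exists_elementarySubstructure_coe_eq _ fun B hB φ ⟨y, hy⟩ => ?_
  choose k hk using fun b : B => hB b.2
  have h1 : (φ.iExs (Fin 1)).Realize (fun b : B => (b : Y)) :=
    Formula.realize_iExs.2 ⟨fun _ => y, hy⟩
  have h2 : (fun b : B => (b : Y)) = g ∘ k := funext fun b => (hk b).symm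
  rw [h2, ← hg.comp k, Formula.realize_iExs] at h1
  obtain ⟨x, hx⟩ := h1
  refine ⟨_, ⟨x 0, rfl⟩, ?_⟩
  have h3 := (hg.comp (Sum.elim k x) φ).1 hx
  convert h3 using 2
  funext i
  rcases i with i | i
  · exact (hk i).symm
  · simp [Subsingleton.elim i 0]

theorem ElemRel.exists_embedding {R : Set (X × Y)} (h : ElemRel L R) (hY : IsSaturated L κ Y)
    (hκ : ℵ₀ ≤ κ) (hR : #R < κ) (hX : #X < κ) :
    ∃ g : X → Y, EqType L (id : X → X) g ∧ ∀ r ∈ R, g r.1 = r.2 := by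
  obtain ⟨R', hR', hel, hdom⟩ := h.exists_extend hY hκ hR Set.univ (by rwa [Cardinal.mk_univ])
  choose g hg using fun x => hdom x trivial
  exact ⟨g, hel.eqType hg, fun r hr =>
    (hel.eq_iff ⟨_, hg r.1⟩ ⟨r, hR' hr⟩).1 rfl⟩

end Embedding

/-! ### Existence of the auxiliary models -/

section Models

variable {L : FirstOrder.Language.{u, v}} {Mbar : Type w} [L.Structure Mbar]
  {κ l : Cardinal.{w}}

theorem exists_elementarySubstructure_card_le (hl : ℵ₀ ≤ l)
    (hL : Cardinal.lift.{w} L.card ≤ Cardinal.lift.{max u v} l) (s : Set Mbar) (hs : #s ≤ l) :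
    ∃ A : L.ElementarySubstructure Mbar, s ⊆ A ∧ #A ≤ l := by
  rcases le_total #Mbar l with h | h
  · refine ⟨⊤, fun _ _ => trivial, ?_⟩
    exact (Cardinal.mk_subtype_le _).trans h
  · obtain ⟨A, hA, hc⟩ := exists_elementarySubstructure_card_eq L s l hl (by simpa using hs)
      hL (by simpa using h)
    exact ⟨A, hA, by simpa using hc.le⟩

theorem exists_saturated_elementarySubstructure [Nonempty Mbar] (hsat : IsSaturated L κ Mbar)
    (hl : ℵ₀ ≤ l) (hL : Cardinal.lift.{w} L.card ≤ Cardinal.lift.{max u v} l) (hκ : 2 ^ l < κ)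
    (s : Set Mbar) (hs : #s ≤ l) :
    ∃ M' : L.ElementarySubstructure Mbar, s ⊆ M' ∧ #M' ≤ 2 ^ l ∧
      IsSaturated L (Order.succ l) M' := by
  obtain ⟨A, hsA, hA⟩ := exists_elementarySubstructure_card_le hl hL s hs
  obtain ⟨S, _, hS, hSsat, ⟨f⟩⟩ := exists_saturated_extension hl
    (hA.trans (Cardinal.cantor l).le) hL
  have hlκ : l < κ := (Cardinal.cantor l).trans hκ
  have hR : ElemRel L (Set.range fun a : A => (f a, (a : Mbar))) :=
    elemRel_range fun φ => (f.map_formula φ id).trans (A.subtype.map_formula φ id).symm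
  obtain ⟨g, hg, hgR⟩ := hR.exists_embedding hsat (hl.trans hlκ.le)
    (Cardinal.mk_range_le.trans_lt (hA.trans_lt hlκ)) (hS.trans_lt hκ)
  obtain ⟨M', hM'⟩ := hg.exists_range
  have hmem : ∀ x, x ∈ M' ↔ x ∈ Set.range g := fun x => by rw [← hM']; rfl
  refine ⟨M', fun x hx => ?_, ?_, ?_⟩
  · exact (hmem x).2 ⟨f ⟨x, hsA hx⟩, hgR _ ⟨⟨x, hsA hx⟩, rfl⟩⟩
  · have : #M' = #(Set.range g) := by rw [← hM']; rfl
    rw [this]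
    exact Cardinal.mk_range_le.trans hS
  · refine hSsat.of_eqType (g := fun x => ⟨g x, (hmem _).2 ⟨x, rfl⟩⟩) (fun φ => ?_) ?_
    · rw [hg, ← M'.subtype.map_formula]
      rfl
    · rintro ⟨y, hy⟩
      obtain ⟨x, rfl⟩ := (hmem y).1 hy
      exact ⟨x, rfl⟩

theorem card_pairLanguage_le {μ : Cardinal.{w}} (hμ : ℵ₀ ≤ μ)
    (hL : Cardinal.lift.{w} L.card ≤ Cardinal.lift.{max u v} μ) :
    Cardinal.lift.{w} (pairLanguage L).card ≤ Cardinal.lift.{max u v} μ := by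
  have h1 : predLanguage.card ≤ 1 := by
    have : Subsingleton predLanguage.Symbols := by
      constructor
      rintro (⟨_, ⟨⟩⟩ | ⟨_, ⟨⟩⟩) (⟨_, ⟨⟩⟩ | ⟨_, ⟨⟩⟩)
      rfl
    exact Cardinal.le_one_iff_subsingleton.2 this
  rw [pairLanguage, Language.card_sum, Cardinal.lift_add]
  refine Cardinal.add_le_of_le (by simpa using hμ) (by simpa using hL) ?_
  have h2 := Cardinal.lift_le.{max u v w}.2 h1
  simp only [Cardinal.lift_lift] at h2 ⊢
  refine le_trans ?_ (show (1 : Cardinal.{max u v w}) ≤ _ by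
    simpa using Cardinal.one_le_aleph0.trans hμ)
  simpa using h2

/-- `M'` has size at most `2 ^ l`, and the saturated extension of `(M', M)` has size at most `2 ^ 2
^ l < κ`. Its `L`-reduct embeds into `Mbar` over `M'`, and `N` is the image of its predicate. Any
finite `s` can be put into `M'`, so each formula over `Mbar` is over some `M'`. -/
theorem exists_simonPair [Nonempty Mbar] (hsat : IsSaturated L κ Mbar)
    (hl : ℵ₀ ≤ l) (hL : Cardinal.lift.{w} L.card ≤ Cardinal.lift.{max u v} l)
    (hκ : 2 ^ (2 : Cardinal.{w}) ^ l < κ) (M : L.ElementarySubstructure Mbar) (hM : #M ≤ l)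
    (s : Finset Mbar) : ∃ D : SimonPair M, (s : Set Mbar) ⊆ D.M' := by
  have h2l : ℵ₀ ≤ (2 : Cardinal.{w}) ^ l := hl.trans (Cardinal.cantor l).le
  have h2κ : (2 : Cardinal.{w}) ^ l < κ := (Cardinal.cantor _).trans hκ
  obtain ⟨M', hsM', hM', hM'sat⟩ := exists_saturated_elementarySubstructure hsat hl hL h2κ
    ((M : Set Mbar) ∪ s) ((Cardinal.mk_union_le _ _).trans (Cardinal.add_le_of_le hl hM
      ((Cardinal.lt_aleph0_of_finite s).le.trans hl)))
  have hle : (M : Set Mbar) ⊆ M' := Set.subset_union_left.trans hsM'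
  have : Nonempty (pairIn M' (M : Set Mbar)) := inferInstanceAs (Nonempty M')
  obtain ⟨S, hSstr, hS, hSsat, ⟨f⟩⟩ := exists_saturated_extension (L := pairLanguage L)
    (A := pairIn M' (M : Set Mbar)) h2l (hM'.trans (Cardinal.cantor _).le)
    (card_pairLanguage_le h2l (hL.trans (Cardinal.lift_le.2 (Cardinal.cantor l).le)))
  let _ : L.Structure S := (LHom.sumInl (L := L) (L' := predLanguage)).reduct S
  have hexp : (LHom.sumInl (L := L) (L' := predLanguage)).IsExpansionOn S :=
    LHom.isExpansionOn_reduct _ _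
  have hR : ElemRel L (Set.range fun a : M' => (f (PairOf.ofBase _ a), (a : Mbar))) := by
    refine elemRel_range fun φ => ?_
    have h1 := f.map_formula ((LHom.sumInl (L := L) (L' := predLanguage)).onFormula φ)
      (fun a : M' => PairOf.ofBase {x : M' | (x : Mbar) ∈ (M : Set Mbar)} a)
    rw [LHom.realize_onFormula, LHom.realize_onFormula] at h1
    exact h1.trans (M'.subtype.map_formula φ id).symm
  obtain ⟨g, hg, hgR⟩ := hR.exists_embedding hsat (h2l.trans h2κ.le)
    (Cardinal.mk_range_le.trans_lt (hM'.trans_lt h2κ)) (hS.trans_lt hκ)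
  obtain ⟨N', hN'⟩ := hg.exists_range
  have hmem : ∀ x, x ∈ N' ↔ x ∈ Set.range g := fun x => by rw [← hN']; rfl
  let PS : Set S := {x | Structure.RelMap (L := pairLanguage L) (M := S) (n := 1)
    (Sum.inr PredSymbol.P) fun _ => x}
  let N : Set Mbar := g '' PS
  have hginj : Function.Injective g := fun x y h => (hg.eq_iff x y).2 h
  have hg' : EqType L (id : S → S) (fun x => (⟨g x, (hmem _).2 ⟨x, rfl⟩⟩ : N')) := fun φ => by
    rw [hg, ← N'.subtype.map_formula]
    rfl
  let ge : S ≃ pairIn N' N := Equiv.ofBijective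
    (fun x => PairOf.ofBase _ (⟨g x, (hmem _).2 ⟨x, rfl⟩⟩ : N')) ⟨fun x y h => by
      exact hginj (congrArg (fun z : N' => (z : Mbar)) h), by
      rintro ⟨y, hy⟩
      obtain ⟨x, rfl⟩ := (hmem y).1 hy
      exact ⟨x, rfl⟩⟩
  let gi : S ≃[pairLanguage L] pairIn N' N :=
    { ge with
      map_fun' := by
        rintro n (F | F) x
        · exact hg'.map_fun F x
        · exact nomatch F
      map_rel' := by
        rintro n (r | r) x
        · exact hg'.map_rel r x
        · rcases r with ⟨⟩
          have h1 : Structure.RelMap (L := pairLanguage L) (M := S) (n := 1)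
              (Sum.inr PredSymbol.P) x ↔
              x 0 ∈ PS := by
            have : x = fun _ => x 0 := funext fun i => by rw [Subsingleton.elim i 0]
            rw [this]
            rfl
          rw [h1]
          exact ⟨fun ⟨y, hy, h⟩ => hginj h ▸ hy, fun h => ⟨x 0, h, rfl⟩⟩ }
  refine ⟨⟨M', N', N, hle, hM'sat.mono (Order.succ_le_succ hM), ?_, ?_, ?_⟩,
    Set.subset_union_right.trans hsM'⟩
  · rintro _ ⟨x, -, rfl⟩
    exact (hmem _).2 ⟨x, rfl⟩
  · exact ⟨gi.toElementaryEmbedding.comp f, fun x => hgR _ ⟨x, rfl⟩⟩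
  · exact IsSaturated.of_eqType (hSsat.mono (Order.succ_le_succ hM')) (g := gi)
      (fun φ => (gi.toElementaryEmbedding.map_formula φ id).symm) gi.surjective

end Models

section FIP

theorem exists_ultrafilter_of_inter_mem {W : Type*} {𝒢 : Set (Set W)} {Z : Set W}
    (huniv : Set.univ ∈ 𝒢) (hinter : ∀ X ∈ 𝒢, ∀ Y ∈ 𝒢, X ∩ Y ∈ 𝒢)
    (hne : ∀ X ∈ 𝒢, (X ∩ Z).Nonempty) : ∃ U : Ultrafilter W, (∀ X ∈ 𝒢, X ∈ U) ∧ Z ∈ U := by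
  have hfip : FIP (insert Z 𝒢) := by
    intro t ht hfin
    have : ∃ X ∈ 𝒢, X ∩ Z ⊆ ⋂₀ t := by
      induction t, hfin using Set.Finite.induction_on with
      | empty => exact ⟨_, huniv, by simp⟩
      | @insert a s _ _ ih =>
        obtain ⟨X, hX, hsub⟩ := ih ((Set.subset_insert _ _).trans ht)
        rw [Set.sInter_insert]
        rcases ht (Set.mem_insert a s) with rfl | ha
        · exact ⟨X, hX, Set.subset_inter Set.inter_subset_right hsub⟩
        · exact ⟨a ∩ X, hinter _ ha _ hX, fun x hx => ⟨hx.1.1, hsub ⟨hx.1.2, hx.2⟩⟩⟩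
    obtain ⟨X, hX, hsub⟩ := this
    exact (hne X hX).mono hsub
  obtain ⟨U, hU⟩ := hfip.exists_ultrafilter
  exact ⟨U, fun X hX => hU X (Set.mem_insert_of_mem _ hX), hU Z (Set.mem_insert _ _)⟩

theorem IsSaturated.exists_mem_of_ultrafilter {L : FirstOrder.Language.{u, v}} {Y : Type w}
    [L.Structure Y] [Nonempty Y] {κ : Cardinal.{w}} (hY : IsSaturated L κ Y) (hκ : ℵ₀ ≤ κ)
    {V : Type*} [Finite V] {B : Set Y} (hB : #B < κ) {𝒳 : Set (Set (V → Y))}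
    (hdef : ∀ X ∈ 𝒳, B.Definable L X) (U : Ultrafilter (V → Y)) (hU : ∀ X ∈ 𝒳, X ∈ U) :
    ∃ a, ∀ X ∈ 𝒳, a ∈ X := by
  obtain ⟨k, ⟨e₀⟩⟩ := Finite.exists_equiv_fin V
  let e : V ≃ ULift.{w} (Fin k) := e₀.trans Equiv.ulift.symm
  obtain ⟨a, ha⟩ := hY.exists_mem_of_fip hκ (V := ULift.{w} (Fin k))
    ((Cardinal.lt_aleph0_of_finite _).trans_le hκ) hB
    (𝒳 := (fun X => (fun g : ULift.{w} (Fin k) → Y => g ∘ e) ⁻¹' X) '' 𝒳) (by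
      rintro _ ⟨X, hX, rfl⟩
      exact (hdef X hX).preimage_comp e)
    (FIP.of_ultrafilter (U.map fun g => g ∘ e.symm) (by
      rintro _ ⟨X, hX, rfl⟩
      rw [Ultrafilter.mem_map]
      filter_upwards [hU X hX] with g hg
      simpa [Function.comp_assoc] using hg))
  exact ⟨a ∘ e, fun X hX => ha _ ⟨X, hX, rfl⟩⟩

end FIP

/-! ### Transfer between `(M', M)` and `(N', N)` -/

section Pairs

variable {L : FirstOrder.Language.{u, v}} {Mbar : Type w} [L.Structure Mbar] {α β γ : Type*}

/-- The tuples of elements of `N`. -/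
def tuples (N : Set Mbar) (α : Type*) : Set (α → Mbar) := {a | ∀ i, a i ∈ N}

theorem definable_setOf_realize {I : Type*} {B : Set Mbar} (b : I → Mbar) (hb : ∀ i, b i ∈ B)
    (φ : L.Formula (I ⊕ α)) : B.Definable L {x : α → Mbar | φ.Realize (Sum.elim b x)} := by
  refine Set.definable_iff_exists_formula_sum.2
    ⟨φ.relabel (Sum.map (fun i => (⟨b i, hb i⟩ : B)) id), ?_⟩
  ext x
  simp only [Set.mem_ofPred_eq, Formula.realize_relabel, Sum.elim_comp_map]
  rfl

theorem realize_congr {X : Type*} [L.Structure X] {φ : L.Formula α} {x y : α → X}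
    (h : ∀ i, x i = y i) : φ.Realize x ↔ φ.Realize y := by
  rw [funext h]

/-- A formula of `L` as a formula of the language of pairs. -/
def toPair (φ : L.Formula α) : (pairLanguage L).Formula α :=
  (LHom.sumInl (L := L) (L' := predLanguage)).onFormula φ

variable (L) in
/-- The formula `P(x)`. -/
def inPred (x : α) : (pairLanguage L).Formula α :=
  Relations.formula₁ (L := pairLanguage L) (Sum.inr PredSymbol.P) (Term.var x)

theorem realize_toPair {A : L.ElementarySubstructure Mbar} {S : Set Mbar} (φ : L.Formula α)
    (x : α → pairIn A S) : (toPair φ).Realize x ↔ φ.Realize fun i => ((x i).toBase : Mbar) := by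
  rw [toPair, LHom.realize_onFormula]
  exact (A.subtype.map_formula φ fun i => (x i).toBase).symm

theorem realize_inPred {A : L.ElementarySubstructure Mbar} {S : Set Mbar} (i : α)
    (x : α → pairIn A S) : (inPred L i).Realize x ↔ ((x i).toBase : Mbar) ∈ S := by
  refine Formula.realize_rel₁.trans ?_
  rfl

namespace SimonPair

variable {M : L.ElementarySubstructure Mbar} (D : SimonPair M)

theorem M'_subset_N' : (D.M' : Set Mbar) ⊆ D.N' := by
  intro x hx
  obtain ⟨f, hf⟩ := D.elementary
  have h := hf ⟨x, hx⟩
  change _ = x at h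
  rw [← h]
  exact ((f (PairOf.ofBase _ ⟨x, hx⟩)).toBase : D.N').2

theorem map_formula (φ : (pairLanguage L).Formula D.M') :
    φ.Realize (fun x => (PairOf.ofBase _ x : pairIn D.M' (M : Set Mbar))) ↔
      φ.Realize (fun x => (PairOf.ofBase _ (⟨x, D.M'_subset_N' x.2⟩ : D.N') :
        pairIn D.N' D.N)) := by
  obtain ⟨f, hf⟩ := D.elementary
  rw [← f.map_formula]
  exact realize_congr fun x => Subtype.ext (hf x)

theorem subset_N : (M : Set Mbar) ⊆ D.N := by
  intro x hx
  have h := D.map_formula (inPred L (⟨x, D.M_le hx⟩ : D.M'))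
  rw [realize_inPred, realize_inPred] at h
  exact h.1 hx

/-- A nonempty set of tuples of elements of `N` which is definable over `M'` contains a tuple of
elements of `M`. -/
theorem inter_tuples_nonempty [Finite β] {Y : Set (β → Mbar)}
    (hY : (D.M' : Set Mbar).Definable L Y) (h : (Y ∩ tuples D.N β).Nonempty) :
    (Y ∩ tuples (M : Set Mbar) β).Nonempty := by
  obtain ⟨φ, rfl⟩ := Set.definable_iff_exists_formula_sum.1 hY
  have key := D.map_formula ((toPair (φ : L.Formula (D.M' ⊕ β)) ⊓
    Formula.iInf fun j : β => inPred L (Sum.inr j : D.M' ⊕ β)).iExs β)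
  simp only [Formula.realize_iExs, Formula.realize_inf, Formula.realize_iInf, realize_toPair,
    realize_inPred] at key
  obtain ⟨x, hx, hxN⟩ := h
  obtain ⟨y, hy, hyM⟩ := key.2 ⟨fun j => PairOf.ofBase _ (⟨x j, D.N_sub (hxN j)⟩ : D.N'),
    (realize_congr (by rintro (i | i) <;> rfl)).1 hx, hxN⟩
  exact ⟨fun j => ((y j).toBase : Mbar),
    (realize_congr (φ := φ) (by rintro (i | i) <;> rfl)).1 hy, hyM⟩

/-- Transfer from `(M', M)` to `(N', N)` of the property that certain definable sets are empty if
they contain no tuples of elements of the smaller model. -/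
theorem transfer_nonempty [Finite β] [Finite γ] (ρ : L.Formula (γ ⊕ β)) {Θ : Set (β → Mbar)}
    (hΘ : (D.M' : Set Mbar).Definable L Θ)
    (h : ∀ c ∈ tuples (M : Set Mbar) γ, ({x | ρ.Realize (Sum.elim c x)} ∩ Θ).Nonempty →
      ({x | ρ.Realize (Sum.elim c x)} ∩ Θ ∩ tuples (M : Set Mbar) β).Nonempty) :
    ∀ c ∈ tuples D.N γ, ({x | ρ.Realize (Sum.elim c x)} ∩ Θ).Nonempty →
      ({x | ρ.Realize (Sum.elim c x)} ∩ Θ ∩ tuples D.N β).Nonempty := by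
  obtain ⟨φ, rfl⟩ := Set.definable_iff_exists_formula_sum.1 hΘ
  let σ : L.Formula ((D.M' ⊕ γ) ⊕ β) := Formula.relabel
    (Sum.elim (fun j => Sum.inl (Sum.inr j)) Sum.inr : γ ⊕ β → (D.M' ⊕ γ) ⊕ β) ρ ⊓
    Formula.relabel (Sum.map Sum.inl id : D.M' ⊕ β → (D.M' ⊕ γ) ⊕ β) φ
  have hσ : ∀ (c : γ → Mbar) (x : β → Mbar),
      σ.Realize (Sum.elim (Sum.elim (fun m : D.M' => (m : Mbar)) c) x) ↔
      x ∈ {x | ρ.Realize (Sum.elim c x)} ∩ {x | φ.Realize (Sum.elim (fun m : D.M' => (m : Mbar)) x)}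
      := by
    intro c x
    simp only [σ, Formula.realize_inf, Formula.realize_relabel, Set.mem_inter_iff,
      Set.mem_ofPred_eq]
    exact and_congr (realize_congr (by rintro (i | i) <;> rfl))
      (realize_congr (by rintro (i | i) <;> rfl))
  -- The transferred formula asserts a counterexample: parameters in `P` for which the intersection
  -- is nonempty but has no point in `P`. One in `(N', N)` would give one in `(M', M)`.
  have key := D.map_formula (((Formula.iInf fun j : γ => inPred L (Sum.inr j : D.M' ⊕ γ)) ⊓
    toPair (σ.iExs β) ⊓ (((Formula.iInf fun j : β => inPred L (Sum.inr j : (D.M' ⊕ γ) ⊕ β)) ⊓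
      toPair σ).iExs β).not).iExs γ)
  simp only [Formula.realize_iExs, Formula.realize_inf, Formula.realize_iInf, realize_toPair,
    realize_inPred, Formula.realize_not] at key
  intro c hc ⟨x, hx⟩
  by_contra hn
  obtain ⟨c', ⟨hc', x', hx'⟩, hn'⟩ := key.2
    ⟨fun j => PairOf.ofBase _ (⟨c j, D.N_sub (hc j)⟩ : D.N'), ⟨hc, x,
      (realize_congr (by rintro ((i | i) | i) <;> rfl)).1 ((hσ c x).2 hx)⟩, fun ⟨y, hyN, hy⟩ =>
      hn ⟨fun j => ((y j).toBase : Mbar), (hσ c _).1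
        ((realize_congr (by rintro ((i | i) | i) <;> rfl)).1 hy), hyN⟩⟩
  obtain ⟨y, hy, hyM⟩ := h (fun j => ((c' j).toBase : Mbar)) hc' ⟨x', (hσ _ _).1
    ((realize_congr (by rintro ((i | i) | i) <;> rfl)).1 hx')⟩
  exact hn' ⟨fun j => PairOf.ofBase _ (⟨y j, D.M_le (hyM j)⟩ : D.M'), hyM,
    (realize_congr (by rintro ((i | i) | i) <;> rfl)).1 ((hσ _ y).2 hy)⟩

/-- Tarski-Vaught property of `N`: a nonempty set definable over `N` contains a tuple of elements
of `N`. -/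
theorem tuples_inter_nonempty [Finite β] {X : Set (β → Mbar)} (hX : D.N.Definable L X)
    (h : X.Nonempty) : (X ∩ tuples D.N β).Nonempty := by
  obtain ⟨A, hA, hX⟩ := Set.definable_iff_finitely_definable.1 hX
  obtain ⟨ρ, rfl⟩ := Set.definable_iff_exists_formula_sum.1 hX
  -- With `Θ` everything, the condition on `M` is just that `M` is elementary in `Mbar`.
  have := D.transfer_nonempty (γ := A) (β := β) ρ (Θ := Set.univ) Set.definable_univ (by
    rintro c hc ⟨x, hx, -⟩
    have h1 : (ρ.iExs β).Realize c := Formula.realize_iExs.2 ⟨x, hx⟩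
    have h2 := (M.subtype.map_formula (ρ.iExs β) fun i => (⟨c i, hc i⟩ : M)).1 h1
    obtain ⟨y, hy⟩ := Formula.realize_iExs.1 h2
    refine ⟨fun j => (y j : Mbar), ⟨?_, trivial⟩, fun j => (y j).2⟩
    exact (realize_congr (by rintro (i | i) <;> rfl)).1 ((M.subtype.map_formula ρ _).2 hy))
    (fun a : A => (a : Mbar)) (fun a => hA a.2) (by rw [Set.inter_univ]; exact h)
  rw [Set.inter_univ] at this
  exact this

theorem exists_mem_tuples_of_ultrafilter [Nonempty Mbar] [Finite α] (hM' : ℵ₀ ≤ #D.M')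
    {B : Set Mbar} (hBN : B ⊆ D.N') (hB : #B ≤ #D.M') {𝒳 : Set (Set (α → Mbar))}
    (hdef : ∀ X ∈ 𝒳, B.Definable L X) (U : Ultrafilter (α → Mbar)) (hU : ∀ X ∈ 𝒳, X ∈ U)
    (hN : tuples D.N α ∈ U) : ∃ a ∈ tuples D.N α, ∀ X ∈ 𝒳, a ∈ X := by
  classical
  have hne : Nonempty (pairIn D.N' D.N) := inferInstanceAs (Nonempty D.N')
  -- The value off `N'` is junk. It is harmless because `U` concentrates on tuples from `N`, which
  -- `r` leaves in place, so pushing `U` forward along `r` gives an ultrafilter on the pair.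
  let r : Mbar → pairIn D.N' D.N := fun x =>
    if h : x ∈ D.N' then PairOf.ofBase _ (⟨x, h⟩ : D.N') else Classical.arbitrary _
  have hr : ∀ x, x ∈ D.N' → ((r x).toBase : Mbar) = x := fun x hx => by
    simp only [r, dif_pos hx]
    rfl
  let c : (α → pairIn D.N' D.N) → α → Mbar := fun a i => ((a i).toBase : Mbar)
  let B' : Set (pairIn D.N' D.N) := r '' B
  have hmem : ∀ X, X ∈ U → c ⁻¹' X ∈ U.map (fun a i => r (a i)) := by
    intro X hX
    rw [Ultrafilter.mem_map]
    filter_upwards [hX, hN] with a ha haN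
    have : c (fun i => r (a i)) = a := funext fun i => hr _ (D.N_sub (haN i))
    change c _ ∈ X
    rwa [this]
  obtain ⟨a, ha⟩ := D.saturated_pair.exists_mem_of_ultrafilter
    (hM'.trans (Order.le_succ _)) (V := α) (B := B')
    (Order.lt_succ_iff.2 (Cardinal.mk_image_le.trans hB))
    (𝒳 := insert (c ⁻¹' tuples D.N α) ((fun X => c ⁻¹' X) '' 𝒳)) (by
      rintro _ (rfl | ⟨X, hX, rfl⟩)
      · have : c ⁻¹' tuples D.N α = {a | (Formula.iInf fun j : α => inPred L
            (Sum.inr j : Empty ⊕ α)).Realize (Sum.elim Empty.elim a)} := by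
          ext a
          simp only [Set.mem_ofPred_eq, Formula.realize_iInf, realize_inPred]
          rfl
        rw [this]
        exact definable_setOf_realize (L := pairLanguage L) _ (fun i => i.elim) _
      · obtain ⟨φ, rfl⟩ := Set.definable_iff_exists_formula_sum.1 (hdef X hX)
        have : c ⁻¹' {v | φ.Realize (Sum.elim (fun b : B => (b : Mbar)) v)} =
            {a | (toPair φ).Realize (Sum.elim (fun b : B => r b) a)} := by
          ext a
          simp only [Set.mem_ofPred_eq, Set.mem_preimage, realize_toPair]
          refine realize_congr ?_
          rintro (i | i)
          · exact (hr _ (hBN i.2)).symm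
          · rfl
        change B'.Definable (pairLanguage L) (c ⁻¹' _)
        rw [this]
        exact definable_setOf_realize (L := pairLanguage L) _
          (fun i => Set.mem_image_of_mem r i.2) _)
    (U.map (fun a i => r (a i))) (by
      rintro _ (rfl | ⟨X, hX, rfl⟩)
      · exact hmem _ hN
      · exact hmem _ (hU X hX))
  exact ⟨c a, ha _ (Set.mem_insert _ _), fun X hX =>
    ha _ (Set.mem_insert_of_mem _ ⟨X, hX, rfl⟩)⟩

end SimonPair

end Pairs

/-- Dependent choice in which the condition on entry `i` sees only the earlier entries. By `hcongr`
the junk values beyond them do not matter. -/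
theorem exists_seq_of_forall_exists {E : Type*} [Nonempty E] (P : ℕ → (ℕ → E) → E → Prop)
    (hcongr : ∀ i g g' x, (∀ j < i, g j = g' j) → P i g x → P i g' x)
    (h : ∀ i g, (∀ j < i, P j g (g j)) → ∃ x, P i g x) : ∃ a : ℕ → E, ∀ i, P i a (a i) := by
  classical
  let pick : ℕ → (ℕ → E) → E := fun i g =>
    if h : ∃ x, P i g x then h.choose else Classical.arbitrary E
  let a : ℕ → E := wellFounded_lt.fix fun i G =>
    pick i fun j => if h : j < i then G j h else Classical.arbitrary E
  have ha : ∀ i, a i = pick i fun j => if j < i then a j else Classical.arbitrary E :=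
    fun i => wellFounded_lt.fix_eq _ i
  refine ⟨a, fun i => ?_⟩
  induction i using Nat.strong_induction_on with
  | _ i ih =>
    have h1 : ∀ j < i, (if j < i then a j else Classical.arbitrary E) = a j :=
      fun j hj => if_pos hj
    have hex : ∃ x, P i (fun j => if j < i then a j else Classical.arbitrary E) x := by
      refine h i _ fun j hj => ?_
      have h2 : (if j < i then a j else Classical.arbitrary E) = a j := h1 j hj
      refine hcongr j a _ _ (fun k hk => (h1 k (hk.trans hj)).symm) ?_
      rw [h2]
      exact ih j hj
    rw [ha]
    refine hcongr i _ _ _ h1 ?_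
    simp only [pick, dif_pos hex]
    exact hex.choose_spec

/-! ### Morley sequences and NIP -/

section Morley

variable {L : FirstOrder.Language.{u, v}} {Mbar : Type w} [L.Structure Mbar] {n : ℕ}
  {κ : Cardinal.{w}}

/-- The ultrafilter `U` on tuples does not distinguish tuples of parameters with the same type
over `M`. -/
def InvariantOver (M : L.ElementarySubstructure Mbar) (U : Ultrafilter (Fin n → Mbar)) : Prop :=
  ∀ (γ : Type) [Finite γ] (b b' : γ → Mbar),
    EqType L (Sum.elim (fun m : M => (m : Mbar)) b) (Sum.elim (fun m : M => (m : Mbar)) b') →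
    ∀ φ : L.Formula ((M ⊕ γ) ⊕ Fin n),
      {a | φ.Realize (Sum.elim (Sum.elim (fun m : M => (m : Mbar)) b) a)} ∈ U ↔
      {a | φ.Realize (Sum.elim (Sum.elim (fun m : M => (m : Mbar)) b') a)} ∈ U

/-- For a tuple `a` from `M`, the truth of `φ` at `a` and `b` is part of the type of `b` over `M`.
-/
theorem invariantOver_of_tuples_mem {M : L.ElementarySubstructure Mbar}
    {U : Ultrafilter (Fin n → Mbar)} (h : tuples (M : Set Mbar) (Fin n) ∈ U) :
    InvariantOver M U := by
  have key : ∀ (γ : Type) [Finite γ] (b b' : γ → Mbar),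
      EqType L (Sum.elim (fun m : M => (m : Mbar)) b) (Sum.elim (fun m : M => (m : Mbar)) b') →
      ∀ φ : L.Formula ((M ⊕ γ) ⊕ Fin n),
        {a | φ.Realize (Sum.elim (Sum.elim (fun m : M => (m : Mbar)) b) a)} ∈ U →
        {a | φ.Realize (Sum.elim (Sum.elim (fun m : M => (m : Mbar)) b') a)} ∈ U := by
    intro γ _ b b' hb φ hφ
    filter_upwards [hφ, h] with a ha haM
    have h1 := hb.comp (Sum.elim id fun j => Sum.inl (⟨a j, haM j⟩ : M)) φ
    exact (realize_congr (by rintro ((i | i) | i) <;> rfl)).1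
      (h1.1 ((realize_congr (by rintro ((i | i) | i) <;> rfl)).1 ha))
  exact fun γ _ b b' hb φ => ⟨key γ b b' hb φ, key γ b' b hb.symm φ⟩

/-- `a` is a sequence of realizations of restrictions of `U`, each over `M` and the previous
elements. -/
def IsMorleySeq (M : L.ElementarySubstructure Mbar) (U : Ultrafilter (Fin n → Mbar))
    (a : ℕ → Fin n → Mbar) : Prop :=
  ∀ i, ∀ X ∈ U, ((M : Set Mbar) ∪ ⋃ j < i, Set.range (a j)).Definable L X → a i ∈ X

/-- Indiscernibility over `M`, by induction on the length: `U` decides a formula at the last entry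
with the earlier entries as parameters, and invariance allows those parameters to be exchanged for
others of the same type over `M`. -/
theorem IsMorleySeq.eqType {M : L.ElementarySubstructure Mbar} {U : Ultrafilter (Fin n → Mbar)}
    {a : ℕ → Fin n → Mbar} (ha : IsMorleySeq M U a) (hU : InvariantOver M U) (k : ℕ) :
    ∀ s t : Fin k → ℕ, StrictMono s → StrictMono t →
      EqType L (Sum.elim (fun m : M => (m : Mbar)) fun p : Fin k × Fin n => a (s p.1) p.2)
        (Sum.elim (fun m : M => (m : Mbar)) fun p : Fin k × Fin n => a (t p.1) p.2) := by
  induction k with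
  | zero =>
    intro s t _ _ φ
    refine realize_congr ?_
    rintro (i | ⟨i, _⟩)
    · rfl
    · exact i.elim0
  | succ k ih =>
    intro s t hs ht φ
    let e : M ⊕ (Fin (k + 1) × Fin n) → (M ⊕ (Fin k × Fin n)) ⊕ Fin n :=
      Sum.elim (fun m => Sum.inl (Sum.inl m)) fun p =>
        Fin.lastCases (motive := fun _ => (M ⊕ (Fin k × Fin n)) ⊕ Fin n) (Sum.inr p.2)
          (fun i => Sum.inl (Sum.inr (i, p.2))) p.1
    have key : ∀ s : Fin (k + 1) → ℕ, StrictMono s →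
        (φ.Realize (Sum.elim (fun m : M => (m : Mbar))
          fun p : Fin (k + 1) × Fin n => a (s p.1) p.2) ↔
        {x | (φ.relabel e).Realize (Sum.elim (Sum.elim (fun m : M => (m : Mbar))
          fun p : Fin k × Fin n => a (s p.1.castSucc) p.2) x)} ∈ U) := by
      intro s hs
      have h1 : φ.Realize (Sum.elim (fun m : M => (m : Mbar))
          fun p : Fin (k + 1) × Fin n => a (s p.1) p.2) ↔
          a (s (Fin.last k)) ∈ {x | (φ.relabel e).Realize
            (Sum.elim (Sum.elim (fun m : M => (m : Mbar))
              fun p : Fin k × Fin n => a (s p.1.castSucc) p.2) x)} := by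
        rw [Set.mem_ofPred_eq, Formula.realize_relabel]
        refine realize_congr ?_
        rintro (m | ⟨i, j⟩)
        · rfl
        · refine Fin.lastCases ?_ (fun i => ?_) i <;> simp [e]
      have hdef : ((M : Set Mbar) ∪ ⋃ j < s (Fin.last k), Set.range (a j)).Definable L
          {x | (φ.relabel e).Realize (Sum.elim (Sum.elim (fun m : M => (m : Mbar))
            fun p : Fin k × Fin n => a (s p.1.castSucc) p.2) x)} := by
        refine definable_setOf_realize _ ?_ _
        rintro (m | p)
        · exact Or.inl m.2
        · refine Or.inr ?_
          simp only [Set.mem_iUnion]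
          exact ⟨s p.1.castSucc, hs (Fin.castSucc_lt_last _), p.2, rfl⟩
      rw [h1]
      constructor
      · intro h
        by_contra hn
        exact ha _ _ (Ultrafilter.compl_mem_iff_notMem.2 hn) hdef.compl h
      · exact fun h => ha _ _ h hdef
    rw [key s hs, key t ht]
    exact hU _ _ _ (ih (s ∘ Fin.castSucc) (t ∘ Fin.castSucc)
      (hs.comp (Fin.strictMono_castSucc)) (ht.comp (Fin.strictMono_castSucc))) _

/-- In a NIP theory a definable set does not alternate along an indiscernible sequence. -/
theorem IsNIP.not_alternating {T : L.Theory} (hNIP : IsNIP.{u, v, w} T) [Nonempty Mbar]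
    (hMbar : Mbar ⊨ T) (hsat : IsSaturated L κ Mbar) (hκ : ℵ₀ < κ) {a : ℕ → Fin n → Mbar}
    (hind : ∀ k, ∀ s t : Fin k → ℕ, StrictMono s → StrictMono t →
      EqType L (fun p : Fin k × Fin n => a (s p.1) p.2) fun p : Fin k × Fin n => a (t p.1) p.2)
    {B : Set Mbar} {Y : Set (Fin n → Mbar)} (hY : B.Definable L Y)
    (halt : ∀ i, a i ∈ Y ↔ Even i) : False := by
  classical
  obtain ⟨B₀, -, hY⟩ := Set.definable_iff_finitely_definable.1 hY
  obtain ⟨φ₀, rfl⟩ := Set.definable_iff_exists_formula_sum.1 hY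
  obtain ⟨l, ⟨e⟩⟩ := Finite.exists_equiv_fin (B₀ : Set Mbar)
  let ψ : L.Formula (Fin n ⊕ Fin l) := φ₀.relabel (Sum.elim (fun b => Sum.inr (e b)) Sum.inl)
  let b : Fin l → Mbar := fun i => (e.symm i : Mbar)
  have hψ : ∀ x, ψ.Realize (Sum.elim x b) ↔
      x ∈ {v | φ₀.Realize (Sum.elim (fun b : (B₀ : Set Mbar) => (b : Mbar)) v)} := by
    intro x
    simp only [ψ, Formula.realize_relabel, Set.mem_ofPred_eq]
    refine realize_congr ?_
    rintro (i | i)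
    · simp [b]
    · rfl
  -- An alternating set on an indiscernible sequence makes every pattern `I` realizable, which is
  -- what NIP excludes. By saturation, finite parts of `I` suffice.
  have hex : ∀ I : Set ℕ, ∃ y : Fin l → Mbar, ∀ i, ψ.Realize (Sum.elim (a i) y) ↔ i ∈ I := by
    intro I
    let Z : ℕ → Set (Fin l → Mbar) := fun j => {y | ψ.Realize (Sum.elim (a j) y) ↔ j ∈ I}
    have hZ : ∀ j, (⋃ i, Set.range (a i)).Definable L (Z j) := by
      intro j
      have h1 : (⋃ i, Set.range (a i)).Definable L {y | ψ.Realize (Sum.elim (a j) y)} :=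
        definable_setOf_realize _ (fun i => Set.mem_iUnion.2 ⟨j, Set.mem_range_self i⟩) _
      by_cases hj : j ∈ I
      · simpa [Z, hj] using h1
      · have : Z j = {y | ψ.Realize (Sum.elim (a j) y)}ᶜ := by
          ext y; simp [Z, hj]
        rw [this]
        exact h1.compl
    have hcount : #(⋃ i, Set.range (a i) : Set Mbar) < κ := by
      refine lt_of_le_of_lt ?_ hκ
      rw [Cardinal.mk_le_aleph0_iff, Set.countable_coe_iff]
      exact Set.countable_iUnion fun i => Set.countable_range _
    have hfin : ∀ m, (⋂ j : Fin m, Z j).Nonempty := by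
      intro m
      -- Of `2 * j` and `2 * j + 1`, take the one whose parity puts `a (s j)` into the alternating
      -- set exactly when `j ∈ I`. Indiscernibility then moves the pattern from `s` to the initial
      -- segment.
      let s : Fin m → ℕ := fun j => if (j : ℕ) ∈ I then 2 * j else 2 * j + 1
      have hs : StrictMono s := by
        intro i j hij
        have : (i : ℕ) < j := hij
        simp only [s]
        split_ifs <;> omega
      let ρ : Fin m → L.Formula ((Fin m × Fin n) ⊕ Fin l) := fun j =>
        ψ.relabel (Sum.map (fun i => (j, i)) id)
      let Φ : L.Formula (Fin m × Fin n) :=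
        (Formula.iInf fun j : Fin m => if (j : ℕ) ∈ I then ρ j else (ρ j).not).iExs (Fin l)
      have hΦ : ∀ s : Fin m → ℕ, Φ.Realize (fun p => a (s p.1) p.2) ↔
          ∃ y, ∀ j, ψ.Realize (Sum.elim (a (s j)) y) ↔ (j : ℕ) ∈ I := by
        intro s
        simp only [Φ, Formula.realize_iExs, Formula.realize_iInf]
        refine exists_congr fun y => forall_congr' fun j => ?_
        have h1 : (ρ j).Realize (Sum.elim (fun p : Fin m × Fin n => a (s p.1) p.2) y) ↔
            ψ.Realize (Sum.elim (a (s j)) y) := by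
          simp only [ρ, Formula.realize_relabel]
          refine realize_congr ?_
          rintro (i | i) <;> rfl
        by_cases hj : (j : ℕ) ∈ I
        · simp [hj, h1]
        · simp [hj, h1]
      have h1 : Φ.Realize (fun p => a (s p.1) p.2) := by
        rw [hΦ]
        refine ⟨b, fun j => ?_⟩
        rw [hψ, halt]
        by_cases hj : (j : ℕ) ∈ I
        · simp [s, hj]
        · simp [s, hj]
      rw [hind m s (fun j => (j : ℕ)) hs Fin.val_strictMono, hΦ] at h1
      obtain ⟨y, hy⟩ := h1
      exact ⟨y, Set.mem_iInter.2 hy⟩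
    obtain ⟨U, hU⟩ := FIP.exists_ultrafilter (𝒳 := Set.range Z) (by
      intro t ht hft
      obtain ⟨m, hm⟩ : ∃ m, t ⊆ Z '' Set.Iio m := by
        induction t, hft using Set.Finite.induction_on with
        | empty => exact ⟨0, Set.empty_subset _⟩
        | @insert X t _ _ ih =>
          obtain ⟨m, hm⟩ := ih ((Set.subset_insert _ _).trans ht)
          obtain ⟨j, rfl⟩ := ht (Set.mem_insert _ _)
          refine ⟨max m (j + 1), Set.insert_subset ⟨j, ?_, rfl⟩ (hm.trans (Set.image_mono ?_))⟩
          · exact lt_max_of_lt_right j.lt_succ_self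
          · exact Set.Iio_subset_Iio (le_max_left _ _)
      obtain ⟨y, hy⟩ := hfin m
      refine ⟨y, fun X hX => ?_⟩
      obtain ⟨j, hj, rfl⟩ := hm hX
      exact Set.mem_iInter.1 hy ⟨j, hj⟩)
    obtain ⟨y, hy⟩ := hsat.exists_mem_of_ultrafilter hκ.le hcount (𝒳 := Set.range Z)
      (by rintro _ ⟨j, rfl⟩; exact hZ j) U hU
    exact ⟨y, fun i => hy _ ⟨i, rfl⟩⟩
  choose bI hbI using hex
  exact hNIP n l ψ (Theory.ModelType.of T Mbar) ⟨a, bI, fun i I => hbI I i⟩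

end Morley

/-! ### The dichotomy and honest definitions -/

section Dichotomy

variable {L : FirstOrder.Language.{u, v}} {Mbar : Type w} [L.Structure Mbar] {n : ℕ}
  {κ : Cardinal.{w}} {M : L.ElementarySubstructure Mbar}

theorem coe_eq_univ_of_finite [Finite Mbar] (M : L.ElementarySubstructure Mbar) :
    (M : Set Mbar) = Set.univ := by
  have h : (Sentence.cardGe L (Nat.card Mbar)).Realize M :=
    (M.realize_sentence _).2 ((Sentence.realize_cardGe L _).2 Nat.cast_card.le)
  have h2 : ((Nat.card Mbar : ℕ) : Cardinal) ≤ #M := (Sentence.realize_cardGe L _).1 h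
  have h3 : Nat.card Mbar ≤ Nat.card M := by
    rwa [← Nat.cast_card (α := M), Nat.cast_le] at h2
  exact Set.eq_of_subset_of_ncard_le (Set.subset_univ _) (by rwa [Set.ncard_univ])

/-- The restriction of `U` to `N` is consistent with `P(x)` and `x ∈ Y`. -/
def SimonPair.Con (D : SimonPair M) (U : Ultrafilter (Fin n → Mbar)) (Y : Set (Fin n → Mbar)) :
    Prop :=
  ∀ X ∈ U, D.N.Definable L X → (X ∩ Y ∩ tuples D.N (Fin n)).Nonempty

namespace SimonPair

variable {D : SimonPair M} {U : Ultrafilter (Fin n → Mbar)} {Y : Set (Fin n → Mbar)}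

theorem Con.exists_ultrafilter (h : D.Con U Y) : ∃ V : Ultrafilter (Fin n → Mbar),
    (∀ X ∈ U, D.N.Definable L X → X ∈ V) ∧ Y ∈ V ∧ tuples D.N (Fin n) ∈ V := by
  obtain ⟨V, hV, hY⟩ := exists_ultrafilter_of_inter_mem
    (𝒢 := {X : Set (Fin n → Mbar) | X ∈ U ∧ D.N.Definable L X}) (Z := Y ∩ tuples D.N (Fin n))
    ⟨Filter.univ_mem, Set.definable_univ⟩
    (fun X hX Z hZ => ⟨Filter.inter_mem hX.1 hZ.1, hX.2.inter hZ.2⟩)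
    (fun X hX => by rw [← Set.inter_assoc]; exact h X hX.1 hX.2)
  exact ⟨V, fun X hX hd => hV X ⟨hX, hd⟩, Filter.mem_of_superset hY Set.inter_subset_left,
    Filter.mem_of_superset hY Set.inter_subset_right⟩

/-- If both were consistent, saturation of the pair would let one choose, step by step in `N`,
realizations of `U` over `M` and the previous choices, in `Y` at even steps and outside at odd ones.
Such a Morley sequence contradicts NIP. -/
theorem not_con_and_con_compl {T : L.Theory} (hNIP : IsNIP.{u, v, w} T) [Nonempty Mbar]
    (hMbar : Mbar ⊨ T) (hsat : IsSaturated L κ Mbar) (hκ : ℵ₀ < κ) (hU : InvariantOver M U)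
    (hY : (D.M' : Set Mbar).Definable L Y) (h : D.Con U Y) (h' : D.Con U Yᶜ) : False := by
  classical
  rcases finite_or_infinite Mbar with hfin | hinf
  -- The cardinal estimates below need `M'` infinite. In a finite model `N` is everything and `U` is
  -- principal, so its point would lie both in `Y` and outside it.
  · obtain ⟨x, rfl⟩ := Ultrafilter.eq_pure_of_finite U
    have hN : D.N = Set.univ := Set.eq_univ_of_univ_subset
      ((coe_eq_univ_of_finite M).symm.subset.trans D.subset_N)
    have hx : D.N.Definable L ({x} : Set (Fin n → Mbar)) := by
      have : ({x} : Set (Fin n → Mbar)) = {a | (Formula.iInf fun j : Fin n =>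
          (Term.var (Sum.inr j)).equal (Term.var (Sum.inl j)) :
            L.Formula (Fin n ⊕ Fin n)).Realize (Sum.elim x a)} := by
        ext a
        simp [funext_iff]
      rw [this]
      exact definable_setOf_realize _ (fun i => hN ▸ trivial) _
    obtain ⟨a, ⟨ha, haY⟩, -⟩ := h {x} rfl hx
    obtain ⟨b, ⟨hb, hbY⟩, -⟩ := h' {x} rfl hx
    rw [Set.mem_singleton_iff.1 ha] at haY
    rw [Set.mem_singleton_iff.1 hb] at hbY
    exact hbY haY
  have hinf' : Infinite D.M' := D.M'.elementarilyEquivalent.infinite_iff.2 hinf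
  have hM' : ℵ₀ ≤ #D.M' := Cardinal.aleph0_le_mk _
  obtain ⟨B₀, hB₀, hY₀⟩ := Set.definable_iff_finitely_definable.1 hY
  obtain ⟨V, hV, hVY, hVN⟩ := h.exists_ultrafilter
  obtain ⟨V', hV', hVY', hVN'⟩ := h'.exists_ultrafilter
  obtain ⟨a, ha⟩ := exists_seq_of_forall_exists
    (fun i g x => x ∈ tuples D.N (Fin n) ∧ (x ∈ Y ↔ Even i) ∧
      ∀ X ∈ U, ((M : Set Mbar) ∪ ⋃ j < i, Set.range (g j)).Definable L X → x ∈ X) (by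
      rintro i g g' x hgg ⟨h1, h2, h3⟩
      refine ⟨h1, h2, ?_⟩
      have : (⋃ j < i, Set.range (g' j)) = ⋃ j < i, Set.range (g j) :=
        Set.iUnion₂_congr fun j hj => by rw [hgg j hj]
      rwa [this]) (by
      intro i g hg
      have hsub : ((M : Set Mbar) ∪ ⋃ j < i, Set.range (g j)) ⊆ D.N := by
        refine Set.union_subset D.subset_N (Set.iUnion₂_subset fun j hj => ?_)
        rintro _ ⟨k, rfl⟩
        exact (hg j hj).1 k
      have hcard : #(((M : Set Mbar) ∪ ⋃ j < i, Set.range (g j)) ∪ B₀ : Set Mbar) ≤ #D.M' := by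
        refine (Cardinal.mk_union_le _ _).trans (Cardinal.add_le_of_le hM'
          ((Cardinal.mk_union_le _ _).trans (Cardinal.add_le_of_le hM' ?_ ?_)) ?_)
        · exact Cardinal.mk_le_mk_of_subset D.M_le
        · refine le_trans ?_ hM'
          rw [Cardinal.mk_le_aleph0_iff, Set.countable_coe_iff]
          exact Set.countable_iUnion fun j => Set.countable_iUnion fun _ => Set.countable_range _
        · exact (Cardinal.lt_aleph0_of_finite B₀).le.trans hM'
      have main : ∀ Z : Set (Fin n → Mbar), (B₀ : Set Mbar).Definable L Z →
          ∀ W : Ultrafilter (Fin n → Mbar), (∀ X ∈ U, D.N.Definable L X → X ∈ W) → Z ∈ W →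
          tuples D.N (Fin n) ∈ W → ∃ x ∈ tuples D.N (Fin n), x ∈ Z ∧
          ∀ X ∈ U, ((M : Set Mbar) ∪ ⋃ j < i, Set.range (g j)).Definable L X → x ∈ X := by
        intro Z hZ W hW hZW hNW
        obtain ⟨x, hxN, hx⟩ := D.exists_mem_tuples_of_ultrafilter hM'
          (Set.union_subset (hsub.trans D.N_sub) (hB₀.trans D.M'_subset_N')) hcard
          (𝒳 := insert Z {X : Set (Fin n → Mbar) | X ∈ U ∧
            ((M : Set Mbar) ∪ ⋃ j < i, Set.range (g j)).Definable L X}) (by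
            rintro X (rfl | hX)
            · exact hZ.mono Set.subset_union_right
            · exact hX.2.mono Set.subset_union_left) W (by
            rintro X (rfl | hX)
            · exact hZW
            · exact hW X hX.1 (hX.2.mono hsub)) hNW
        exact ⟨x, hxN, hx _ (Set.mem_insert _ _), fun X hX hd =>
          hx _ (Set.mem_insert_of_mem _ ⟨hX, hd⟩)⟩
      by_cases hi : Even i
      · obtain ⟨x, h1, h2, h3⟩ := main Y hY₀ V hV hVY hVN
        exact ⟨x, h1, iff_of_true h2 hi, h3⟩
      · obtain ⟨x, h1, h2, h3⟩ := main Yᶜ hY₀.compl V' hV' hVY' hVN'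
        exact ⟨x, h1, iff_of_false h2 hi, h3⟩)
  have hmor : IsMorleySeq M U a := fun i => (ha i).2.2
  exact hNIP.not_alternating hMbar hsat hκ (fun k s t hs ht =>
    (hmor.eqType hU k s t hs ht).comp Sum.inr) hY fun i => (ha i).2.1

theorem exists_of_not_con (h : ¬ D.Con U Yᶜ) :
    ∃ X ∈ U, D.N.Definable L X ∧ X ∩ tuples D.N (Fin n) ⊆ Y := by
  simp only [Con, not_forall, Set.not_nonempty_iff_eq_empty] at h
  obtain ⟨X, hX, hd, h⟩ := h
  refine ⟨X, hX, hd, fun x hx => ?_⟩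
  by_contra hn
  have : x ∈ X ∩ Yᶜ ∩ tuples D.N (Fin n) := ⟨⟨hx.1, hn⟩, hx.2⟩
  rw [h] at this
  exact this

end SimonPair

/-- Semantic form of honesty over `M`. -/
def IsHonestSet (M : L.ElementarySubstructure Mbar) (Θ : Set (Fin n → Mbar)) : Prop :=
  ∀ Z : Set (Fin n → Mbar), (M : Set Mbar).Definable L Z →
    Θ ∩ tuples (M : Set Mbar) (Fin n) ⊆ Z → Θ ⊆ Z

namespace SimonPair

variable {D : SimonPair M} {U : Ultrafilter (Fin n → Mbar)} {Y : Set (Fin n → Mbar)}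

/-- A point of `Θ` outside an `M`-definable `Z` can be found in `N`, where it lies in `Y`.
Elementarity of the pairs moves it, as a point of `Y` outside `Z`, into `M`, where `Y` is contained
in `Θ`. -/
theorem isHonestSet (hY : (D.M' : Set Mbar).Definable L Y) {Θ : Set (Fin n → Mbar)}
    (hΘ : D.N.Definable L Θ) (h1 : Θ ∩ tuples D.N (Fin n) ⊆ Y)
    (h2 : Y ∩ tuples (M : Set Mbar) (Fin n) ⊆ Θ) : IsHonestSet M Θ := by
  intro Z hZ hsub x hx
  by_contra hxZ
  obtain ⟨y, ⟨hyΘ, hyZ⟩, hyN⟩ := D.tuples_inter_nonempty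
    (hΘ.inter (hZ.compl.mono D.subset_N)) ⟨x, hx, hxZ⟩
  obtain ⟨z, ⟨hzY, hzZ⟩, hzM⟩ := D.inter_tuples_nonempty (hY.inter (hZ.compl.mono D.M_le))
    ⟨y, ⟨h1 ⟨hyΘ, hyN⟩, hyZ⟩, hyN⟩
  exact hzZ (hsub ⟨h2 ⟨hzY, hzM⟩, hzM⟩)

/-- Existence of honest definitions. -/
theorem exists_honest_definition {T : L.Theory} (hNIP : IsNIP.{u, v, w} T) [Nonempty Mbar]
    (hMbar : Mbar ⊨ T) (hsat : IsSaturated L κ Mbar) (hκ : ℵ₀ < κ)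
    (hY : (D.M' : Set Mbar).Definable L Y) :
    ∃ Θ, D.N.Definable L Θ ∧ Θ ∩ tuples D.N (Fin n) ⊆ Y ∧
      Y ∩ tuples (M : Set Mbar) (Fin n) ⊆ Θ := by
  by_contra! hn
  -- The candidates `Θ` with `Θ(N) ⊆ Y` are closed under union. If none covers `Y(M)`, some `V`
  -- concentrates on `Y(M)` and avoids them all. But `V` is invariant and consistent with `Y`, so
  -- the dichotomy produces a candidate inside `V`.
  obtain ⟨V, hV, hVY⟩ := exists_ultrafilter_of_inter_mem
    (𝒢 := {X : Set (Fin n → Mbar) | D.N.Definable L Xᶜ ∧ Xᶜ ∩ tuples D.N (Fin n) ⊆ Y})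
    (Z := Y ∩ tuples (M : Set Mbar) (Fin n)) (by simp) (by
      rintro X ⟨hX, hX'⟩ Z ⟨hZ, hZ'⟩
      rw [Set.mem_ofPred_eq, Set.compl_inter, Set.union_inter_distrib_right]
      exact ⟨hX.union hZ, Set.union_subset hX' hZ'⟩) (by
      rintro X ⟨hX, hX'⟩
      obtain ⟨y, hy, hyX⟩ := Set.not_subset.1 (hn _ hX hX')
      exact ⟨y, not_not.1 hyX, hy⟩)
  have hVM : tuples (M : Set Mbar) (Fin n) ∈ V := Filter.mem_of_superset hVY Set.inter_subset_right
  have hcon : D.Con V Y := by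
    intro X hX _
    obtain ⟨x, hx, hxY, hxM⟩ := V.nonempty_of_mem (Filter.inter_mem hX hVY)
    exact ⟨x, ⟨hx, hxY⟩, fun i => D.subset_N (hxM i)⟩
  obtain ⟨X, hX, hd, hsub⟩ := exists_of_not_con fun h =>
    not_con_and_con_compl hNIP hMbar hsat hκ (invariantOver_of_tuples_mem hVM) hY hcon h
  have := hV Xᶜ (by
    rw [Set.mem_ofPred_eq, compl_compl]
    exact ⟨hd, hsub⟩)
  exact Ultrafilter.compl_mem_iff_notMem.1 this hX

/-- Take a union: the witness of inconsistency brings membership in `U`, an honest definition of `Y`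
brings the trace, and both stay inside `Y` on `N`. -/
theorem exists_isHonestSet {T : L.Theory} (hNIP : IsNIP.{u, v, w} T) [Nonempty Mbar]
    (hMbar : Mbar ⊨ T) (hsat : IsSaturated L κ Mbar) (hκ : ℵ₀ < κ)
    (hY : (D.M' : Set Mbar).Definable L Y) (h : ¬ D.Con U Yᶜ) :
    ∃ Θ ∈ U, D.N.Definable L Θ ∧ IsHonestSet M Θ ∧
      Θ ∩ tuples (M : Set Mbar) (Fin n) = Y ∩ tuples (M : Set Mbar) (Fin n) := by
  obtain ⟨X, hX, hd, hsub⟩ := exists_of_not_con h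
  obtain ⟨Θ, hΘ, h1, h2⟩ := exists_honest_definition hNIP hMbar hsat hκ hY
  have h3 : (X ∪ Θ) ∩ tuples D.N (Fin n) ⊆ Y := by
    rw [Set.union_inter_distrib_right]
    exact Set.union_subset hsub h1
  have h4 : Y ∩ tuples (M : Set Mbar) (Fin n) ⊆ X ∪ Θ := h2.trans Set.subset_union_right
  refine ⟨X ∪ Θ, Filter.mem_of_superset hX Set.subset_union_left, hd.union hΘ,
    isHonestSet hY (hd.union hΘ) h3 h4, ?_⟩
  ext x
  exact ⟨fun hx => ⟨h3 ⟨hx.1, fun i => D.subset_N (hx.2 i)⟩, hx.2⟩, fun hx => ⟨h4 hx, hx.2⟩⟩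

/-- Otherwise the dichotomy gives an `N`-definable `X ∈ U` disjoint from `Y` on `N`. Honesty,
applied to complements, says that an `M`-definable set meeting `Y` meets it in `M`. Transferred to
`N`, this applies to `X`, which meets `Y` since both are in `U`. -/
theorem not_con_compl_of_isHonestSet {T : L.Theory} (hNIP : IsNIP.{u, v, w} T) [Nonempty Mbar]
    (hMbar : Mbar ⊨ T) (hsat : IsSaturated L κ Mbar) (hκ : ℵ₀ < κ) (hU : InvariantOver M U)
    (hY : (D.M' : Set Mbar).Definable L Y) (hhon : IsHonestSet M Y) (hYU : Y ∈ U) :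
    ¬ D.Con U Yᶜ := by
  intro hcon
  have h1 : ¬ D.Con U Yᶜᶜ := by
    rw [compl_compl]
    exact fun h => not_con_and_con_compl hNIP hMbar hsat hκ hU hY h hcon
  obtain ⟨X, hX, hd, hsub⟩ := exists_of_not_con h1
  obtain ⟨A, hA, hd⟩ := Set.definable_iff_finitely_definable.1 hd
  obtain ⟨ρ, rfl⟩ := Set.definable_iff_exists_formula_sum.1 hd
  obtain ⟨x, ⟨hxX, hxY⟩, hxN⟩ := D.transfer_nonempty (γ := A) ρ hY (by
    rintro c hc ⟨x, hx, hxY⟩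
    by_contra hn
    have h2 := hhon {x | ρ.Realize (Sum.elim c x)}ᶜ
      (definable_setOf_realize c hc ρ).compl (fun y hy hy' => hn ⟨y, ⟨hy', hy.1⟩, hy.2⟩)
    exact h2 hxY hx) (fun a : A => (a : Mbar)) (fun a => hA a.2)
    (U.nonempty_of_mem (Filter.inter_mem hX hYU))
  exact hsub ⟨hxX, hxN⟩ hxY

end SimonPair

end Dichotomy

/-! ### Formulas with parameters, definable sets and automorphisms -/

section Parameters

/-- Renaming constants amounts to interpreting the old ones through `f`. This serves both inclusions
of parameter sets and the action of automorphisms. -/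
theorem realize_onFormula_lhomWithConstantsMap {L : FirstOrder.Language.{u, v}} {X : Type w}
    {α γ : Type*} [L.Structure X] (f : α → X) (ψ : L[[α]].Formula γ) (a : γ → X) :
    ((L.lhomWithConstantsMap f).onFormula ψ).Realize a ↔
      Formula.Realize (BoundedFormula.constantsVarsEquiv ψ : L.Formula (α ⊕ γ))
        (Sum.elim f a) := by
  let _ : (constantsOn α).Structure X := constantsOn.structure f
  have : (LHom.constantsOnMap f).IsExpansionOn X := constantsOnMap_isExpansionOn 
    (fα := f) (fβ := id) rfl
  have : (L.lhomWithConstantsMap f).IsExpansionOn X :=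
    LHom.sumMap_isExpansionOn (LHom.id L) (LHom.constantsOnMap f) X
  rw [LHom.realize_onFormula]
  exact BoundedFormula.realize_constantsVarsEquiv.symm

variable {L : FirstOrder.Language.{u, v}} {Mbar : Type w} [L.Structure Mbar] {n : ℕ}
  {M : L.ElementarySubstructure Mbar}

theorem exists_formula_realize_iff {I : Type*} (b : I → Mbar) (φ : L.Formula (I ⊕ Fin n)) :
    ∃ ψ : L[[Mbar]].Formula (Fin n), ∀ a, ψ.Realize a ↔ φ.Realize (Sum.elim b a) := by
  refine ⟨BoundedFormula.constantsVarsEquiv.symm (φ.relabel (Sum.map b id)), fun a => ?_⟩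
  have := BoundedFormula.realize_constantsVarsEquiv (φ := (BoundedFormula.constantsVarsEquiv.symm
    (φ.relabel (Sum.map b id)) : L[[Mbar]].Formula (Fin n))) (v := a) (xs := default)
  rw [Equiv.apply_symm_apply] at this
  refine this.symm.trans (Formula.realize_relabel.trans (realize_congr ?_))
  rintro (i | i) <;> rfl

theorem realize_withParams (A : Set Mbar) (φ : L[[A]].Formula (Fin n)) (a : Fin n → Mbar) :
    (withParams A φ).Realize a ↔ φ.Realize a := by
  rw [withParams, realize_onFormula_lhomWithConstantsMap, ← realize_constantsVarsEquiv]

theorem realize_onFormula_equiv (σ : Mbar ≃[L] Mbar) (ψ : L[[Mbar]].Formula (Fin n))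
    (a : Fin n → Mbar) :
    ((L.lhomWithConstantsMap σ).onFormula ψ).Realize a ↔ ψ.Realize (σ.symm ∘ a) := by
  rw [realize_onFormula_lhomWithConstantsMap]
  have h := BoundedFormula.realize_constantsVarsEquiv (φ := ψ) (v := σ.symm ∘ a) (xs := default)
  refine Iff.trans ?_ h
  refine (realize_congr ?_).trans (StrongHomClass.realize_formula σ _)
  rintro (i | i)
  · rfl
  · exact (σ.apply_symm_apply (a i)).symm

/-- The set defined by a formula with parameters in `Mbar`. -/
def solutionSet (ψ : L[[Mbar]].Formula (Fin n)) : Set (Fin n → Mbar) := {a | ψ.Realize a}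

theorem definable_solutionSet (ψ : L[[Mbar]].Formula (Fin n)) :
    ∃ B : Finset Mbar, (B : Set Mbar).Definable L (solutionSet ψ) := by
  have h : (Set.univ : Set Mbar).Definable L (solutionSet ψ) := by
    convert definable_setOf_realize (id : Mbar → Mbar) (fun _ => Set.mem_univ _)
      (BoundedFormula.constantsVarsEquiv ψ : L.Formula (Mbar ⊕ Fin n)) using 1
    ext a
    exact (BoundedFormula.realize_constantsVarsEquiv (φ := ψ) (v := a) (xs := default)).symm
  obtain ⟨B, -, hB⟩ := Set.definable_iff_finitely_definable.1 h
  exact ⟨B, hB⟩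

theorem definable_solutionSet_withParams (A : Set Mbar) (φ : L[[A]].Formula (Fin n)) :
    A.Definable L (solutionSet (withParams A φ)) :=
  ⟨φ, Set.ext fun a => realize_withParams A φ a⟩

theorem exists_solutionSet_withParams_eq {A : Set Mbar} {Y : Set (Fin n → Mbar)}
    (hY : A.Definable L Y) : ∃ φ : L[[A]].Formula (Fin n), solutionSet (withParams A φ) = Y := by
  obtain ⟨φ, rfl⟩ := hY
  exact ⟨φ, Set.ext fun a => realize_withParams A φ a⟩

theorem trace_eq (ψ : L[[Mbar]].Formula (Fin n)) :
    trace M ψ = solutionSet ψ ∩ tuples (M : Set Mbar) (Fin n) := Set.inter_comm _ _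

theorem isHonest_iff (θ : L[[Mbar]].Formula (Fin n)) :
    IsHonest M θ ↔ IsHonestSet M (solutionSet θ) := by
  constructor
  · intro h Z hZ hsub
    obtain ⟨φ, rfl⟩ := exists_solutionSet_withParams_eq hZ
    exact fun a ha => h φ (fun x hx => ⟨hx.1, hsub ⟨hx.2, hx.1⟩⟩) a ha
  · intro h φ hsub a ha
    exact h _ (definable_solutionSet_withParams (M : Set Mbar) φ)
      (fun x hx => (hsub ⟨hx.2, hx.1⟩).2) ha

theorem EqType.exists_automorphism {κ : Cardinal.{w}} (hhom : IsStronglyHomogeneous L κ Mbar)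
    {I : Type w} (hI : #I < κ) {x y : I → Mbar} (h : EqType L x y) :
    ∃ σ : Mbar ≃[L] Mbar, ∀ i, σ (x i) = y i := by
  obtain ⟨σ, hσ⟩ := hhom (Set.range x) (Cardinal.mk_range_le.trans_lt hI)
    (fun b => y b.2.choose) (by
    have := h.comp fun b : Set.range x => b.2.choose
    intro φ
    refine (realize_congr fun b => ?_).trans (this φ)
    exact b.2.choose_spec.symm)
  refine ⟨σ, fun i => (hσ ⟨x i, i, rfl⟩).trans ((h.eq_iff _ _).1 ?_)⟩
  exact (⟨i, rfl⟩ : ∃ j, x j = x i).choose_spec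

theorem IsMonster.isStronglyHomogeneous {κ : Cardinal.{w}} (h : IsMonster L κ Mbar)
    (hκ : ℵ₀ < κ) : IsStronglyHomogeneous L κ Mbar :=
  h.card_eq_or_homogeneous.elim (fun hc => h.saturated.isStronglyHomogeneous hκ hc) id

end Parameters

/-! ### Complete types as ultrafilters -/

section Types

variable {L : FirstOrder.Language.{u, v}} {Mbar : Type w} [L.Structure Mbar] [Nonempty Mbar]
  {n : ℕ} {M : L.ElementarySubstructure Mbar}

/-- The type `p` consists of the formulas defining sets in the ultrafilter `U`. -/
def IsTypeOf (U : Ultrafilter (Fin n → Mbar)) (p : TypeSpace L Mbar n) : Prop :=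
  ∀ ψ : L[[Mbar]].Formula (Fin n), InType ψ p ↔ solutionSet ψ ∈ U

theorem exists_realize_of_mem_completeType {K : FirstOrder.Language} {Y : Type w}
    [K.Structure Y] [Nonempty Y] {p : (K.completeTheory Y).CompleteType (Fin n)}
    {ψ : K.Formula (Fin n)} (h : Formula.equivSentence ψ ∈ p) : ∃ a : Fin n → Y, ψ.Realize a := by
  obtain ⟨A, v, rfl⟩ := Theory.exists_modelType_is_realized_in _ p
  have hv := Theory.CompleteType.formula_mem_typeOf.1 h
  by_contra hn
  let φ : K.Sentence := (Formula.iExs (Fin n) (ψ.relabel (Sum.inr : Fin n → Empty ⊕ Fin n))).not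
  have h1 : Y ⊨ φ := by
    refine Formula.realize_not.2 fun h => ?_
    obtain ⟨x, hx⟩ := Formula.realize_iExs.1 h
    exact hn ⟨x, (Formula.realize_relabel (g := (Sum.inr : Fin n → Empty ⊕ Fin n))).1 hx⟩
  refine Formula.realize_not.1 (A.is_model.realize_of_mem φ h1) (Formula.realize_iExs.2 ⟨v, ?_⟩)
  exact (Formula.realize_relabel (g := (Sum.inr : Fin n → Empty ⊕ Fin n))).2 hv

theorem exists_realize_of_inType {p : TypeSpace L Mbar n} {ψ : L[[Mbar]].Formula (Fin n)}
    (h : InType ψ p) : ∃ a : Fin n → Mbar, ψ.Realize a :=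
  exists_realize_of_mem_completeType (K := L[[Mbar]]) h

theorem inType_not {p : TypeSpace L Mbar n} {ψ : L[[Mbar]].Formula (Fin n)} :
    InType ψ.not p ↔ ¬ InType ψ p := by
  rw [InType, Formula.equivSentence_not, Theory.CompleteType.not_mem_iff, InType]

theorem inType_inf {p : TypeSpace L Mbar n} {φ ψ : L[[Mbar]].Formula (Fin n)} :
    InType (φ ⊓ ψ) p ↔ InType φ p ∧ InType ψ p := by
  have := Set.ext_iff.1 (Theory.CompleteType.typesWith_inf (T := L.elementaryDiagram Mbar)
    (Formula.equivSentence φ) (Formula.equivSentence ψ)) p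
  rw [InType, Formula.equivSentence_inf]
  exact this

/-- Each formula of `p` is realized in `Mbar`, because the elementary diagram is complete. So the
sets defined by `p` generate a proper filter, and any ultrafilter above it represents `p`. -/
theorem exists_isTypeOf_of_type (p : TypeSpace L Mbar n) :
    ∃ U : Ultrafilter (Fin n → Mbar), IsTypeOf U p := by
  have htop : InType (⊤ : L[[Mbar]].Formula (Fin n)) p := by
    by_contra h
    obtain ⟨a, ha⟩ := exists_realize_of_inType (inType_not.2 h)
    exact ha (Formula.realize_top.2 trivial)
  obtain ⟨U, hU, -⟩ := exists_ultrafilter_of_inter_mem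
    (𝒢 := {X | ∃ ψ : L[[Mbar]].Formula (Fin n), InType ψ p ∧ solutionSet ψ = X}) (Z := Set.univ)
    ⟨⊤, htop, Set.ext fun a => iff_of_true (Formula.realize_top.2 trivial) trivial⟩ (by
      rintro _ ⟨φ, hφ, rfl⟩ _ ⟨ψ, hψ, rfl⟩
      exact ⟨φ ⊓ ψ, inType_inf.2 ⟨hφ, hψ⟩, Set.ext fun a => Formula.realize_inf⟩) (by
      rintro _ ⟨φ, hφ, rfl⟩
      rw [Set.inter_univ]
      exact exists_realize_of_inType hφ)
  refine ⟨U, fun ψ => ⟨fun h => hU _ ⟨ψ, h, rfl⟩, fun h => ?_⟩⟩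
  by_contra hn
  obtain ⟨a, h1, h2⟩ := U.nonempty_of_mem
    (Filter.inter_mem h (hU _ ⟨ψ.not, inType_not.2 hn, rfl⟩))
  exact h2 h1

/-- The type is that of the tuple of coordinate functions in the ultrapower along `U`. -/
theorem exists_completeType_of_ultrafilter {K : FirstOrder.Language} {Y : Type w}
    [K.Structure Y] [Nonempty Y] (U : Ultrafilter (Fin n → Y)) :
    ∃ p : (K.completeTheory Y).CompleteType (Fin n), ∀ ψ : K.Formula (Fin n),
      Formula.equivSentence ψ ∈ p ↔ {a | ψ.Realize a} ∈ U := by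
  have : Ultrapower U Y ⊨ K.completeTheory Y := by
    refine (Theory.model_iff _).2 fun φ hφ => ?_
    have h := (Ultrapower.eqType_const (L := K) U (Empty.elim : Empty → Y)) φ
    refine (realize_congr ?_).1 (h.2 ?_)
    · exact fun i => i.elim
    · exact (realize_congr fun i => i.elim).1 hφ
  exact ⟨(K.completeTheory Y).typeOf fun i => Ultrapower.mk U fun a => a i, fun ψ =>
    Theory.CompleteType.formula_mem_typeOf.trans
      (Ultrapower.realize_mk U ψ fun (i : Fin n) (a : Fin n → Y) => a i)⟩

theorem exists_isTypeOf_of_ultrafilter (U : Ultrafilter (Fin n → Mbar)) :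
    ∃ p : TypeSpace L Mbar n, IsTypeOf U p :=
  exists_completeType_of_ultrafilter (K := L[[Mbar]]) U

theorem typeSpace_eq_of_forall {p q : TypeSpace L Mbar n}
    (h : ∀ ψ : L[[Mbar]].Formula (Fin n), InType ψ p → InType ψ q) : p = q := by
  refine SetLike.ext fun φ => ?_
  obtain ⟨ψ, rfl⟩ := Formula.equivSentence.surjective φ
  refine ⟨h ψ, fun hq => ?_⟩
  by_contra hp
  exact inType_not.1 (h _ (inType_not.2 hp)) hq

theorem IsInvariant.invariantOver {κ : Cardinal.{w}} (hhom : IsStronglyHomogeneous L κ Mbar)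
    (hκ : ℵ₀ ≤ κ) (hM : #M < κ) {p : TypeSpace L Mbar n} (hp : IsInvariant M p)
    {U : Ultrafilter (Fin n → Mbar)} (hU : IsTypeOf U p) : InvariantOver M U := by
  have key : ∀ (γ : Type) [Finite γ] (b b' : γ → Mbar),
      EqType L (Sum.elim (fun m : M => (m : Mbar)) b) (Sum.elim (fun m : M => (m : Mbar)) b') →
      ∀ φ : L.Formula ((M ⊕ γ) ⊕ Fin n),
        {a | φ.Realize (Sum.elim (Sum.elim (fun m : M => (m : Mbar)) b) a)} ∈ U →
        {a | φ.Realize (Sum.elim (Sum.elim (fun m : M => (m : Mbar)) b') a)} ∈ U := by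
    intro γ _ b b' hb φ hφ
    have hI : #(M ⊕ ULift.{w} γ) < κ := by
      rw [Cardinal.mk_sum, Cardinal.lift_id, Cardinal.lift_id]
      exact Cardinal.add_lt_of_lt hκ hM ((Cardinal.lt_aleph0_of_finite _).trans_le hκ)
    obtain ⟨σ, hσ⟩ := EqType.exists_automorphism hhom hI
      (hb.comp (Sum.map id ULift.down : M ⊕ ULift.{w} γ → M ⊕ γ))
    obtain ⟨ψ, hψ⟩ := exists_formula_realize_iff (Sum.elim (fun m : M => (m : Mbar)) b) φ
    have h1 : InType ψ p := (hU ψ).2 (Filter.mem_of_superset hφ fun a ha => (hψ a).2 ha)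
    have h2 : InType ((L.lhomWithConstantsMap σ).onFormula ψ) p :=
      (hp σ fun m hm => hσ (Sum.inl ⟨m, hm⟩)).subset ⟨ψ, h1, rfl⟩
    refine Filter.mem_of_superset ((hU _).1 h2) fun a ha => ?_
    have h3 := (hψ _).1 ((realize_onFormula_equiv σ ψ a).1 ha)
    refine (realize_congr ?_).1 ((StrongHomClass.realize_formula σ φ).2 h3)
    rintro ((i | i) | i)
    · exact hσ (Sum.inl i)
    · exact hσ (Sum.inr ⟨i⟩)
    · exact σ.apply_symm_apply (a i)
  exact fun γ _ b b' hb φ => ⟨key γ b b' hb φ, key γ b' b hb.symm φ⟩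

end Types

/-! ### Honest traces and the retraction -/

section HonestTrace

variable {L : FirstOrder.Language.{u, v}} {Mbar : Type w} [L.Structure Mbar] {n : ℕ}
  {κ : Cardinal.{w}} {M : L.ElementarySubstructure Mbar} {U : Ultrafilter (Fin n → Mbar)}

/-- The set `Y` has the same trace on `M` as some honest definable set in `U`. -/
def HonestTrace (M : L.ElementarySubstructure Mbar) (U : Ultrafilter (Fin n → Mbar))
    (Y : Set (Fin n → Mbar)) : Prop :=
  ∃ Θ ∈ U, (Set.univ : Set Mbar).Definable L Θ ∧ IsHonestSet M Θ ∧
    Θ ∩ tuples (M : Set Mbar) (Fin n) = Y ∩ tuples (M : Set Mbar) (Fin n)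

theorem exists_simonPair_definable {Y Z : Set (Fin n → Mbar)}
    (hD : ∀ s : Finset Mbar, ∃ D : SimonPair M, (s : Set Mbar) ⊆ D.M')
    (hY : (Set.univ : Set Mbar).Definable L Y) (hZ : (Set.univ : Set Mbar).Definable L Z) :
    ∃ D : SimonPair M, (D.M' : Set Mbar).Definable L Y ∧ (D.M' : Set Mbar).Definable L Z := by
  classical
  obtain ⟨B, -, hB⟩ := Set.definable_iff_finitely_definable.1 hY
  obtain ⟨C, -, hC⟩ := Set.definable_iff_finitely_definable.1 hZ
  obtain ⟨D, h⟩ := hD (B ∪ C)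
  rw [Finset.coe_union, Set.union_subset_iff] at h
  exact ⟨D, hB.mono h.1, hC.mono h.2⟩

theorem SimonPair.not_con_compl_inter {D : SimonPair M} {Y Z : Set (Fin n → Mbar)}
    (hY : ¬ D.Con U Yᶜ) (hZ : ¬ D.Con U Zᶜ) : ¬ D.Con U (Y ∩ Z)ᶜ := by
  intro h
  obtain ⟨X, hX, hXd, hXY⟩ := exists_of_not_con hY
  obtain ⟨X', hX', hXd', hXZ⟩ := exists_of_not_con hZ
  obtain ⟨x, ⟨⟨h1, h2⟩, h3⟩, h4⟩ := h (X ∩ X') (Filter.inter_mem hX hX') (hXd.inter hXd')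
  exact h3 ⟨hXY ⟨h1, h4⟩, hXZ ⟨h2, h4⟩⟩

/-- A set of `U` definable over `N` meets the witness against `Yᶜ`, and by Tarski-Vaught for `N`
they meet in `N`, hence in `Y`. -/
theorem SimonPair.con_of_not_con_compl {D : SimonPair M} {Y : Set (Fin n → Mbar)}
    (hY : ¬ D.Con U Yᶜ) : D.Con U Y := by
  intro X hX hXd
  obtain ⟨X', hX', hXd', hXY⟩ := exists_of_not_con hY
  obtain ⟨x, ⟨h1, h2⟩, h3⟩ := D.tuples_inter_nonempty (hXd.inter hXd')
    (U.nonempty_of_mem (Filter.inter_mem hX hX'))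
  exact ⟨x, ⟨h1, hXY ⟨h2, h3⟩⟩, h3⟩

theorem SimonPair.isHonestSet_of_definable (D : SimonPair M) {Θ : Set (Fin n → Mbar)}
    (hΘ : (M : Set Mbar).Definable L Θ) : IsHonestSet M Θ := by
  intro Z hZ hsub x hx
  by_contra hxZ
  have hd := hΘ.inter hZ.compl
  obtain ⟨y, hy, hyN⟩ := D.tuples_inter_nonempty (hd.mono D.subset_N) ⟨x, hx, hxZ⟩
  obtain ⟨z, hz, hzM⟩ := D.inter_tuples_nonempty (hd.mono D.M_le) ⟨y, hy, hyN⟩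
  exact hz.2 (hsub ⟨hz.1, hzM⟩)

variable [Nonempty Mbar] {T : L.Theory} (hNIP : IsNIP.{u, v, w} T) (hMbar : Mbar ⊨ T)
  (hsat : IsSaturated L κ Mbar) (hκ : ℵ₀ < κ) (hU : InvariantOver M U)
  (hD : ∀ s : Finset Mbar, ∃ D : SimonPair M, (s : Set Mbar) ⊆ D.M')

include hNIP hMbar hsat hκ hU hD

/-- Neither complement is consistent over a common pair, hence neither is the complement of the
intersection. So the intersection has a point in `N`, and elementarity brings one into `M`. -/
theorem IsHonestSet.inter_tuples_nonempty {Θ Θ' : Set (Fin n → Mbar)} (h : IsHonestSet M Θ)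
    (h' : IsHonestSet M Θ') (hΘ : Θ ∈ U) (hΘ' : Θ' ∈ U)
    (hd : (Set.univ : Set Mbar).Definable L Θ) (hd' : (Set.univ : Set Mbar).Definable L Θ') :
    (Θ ∩ Θ' ∩ tuples (M : Set Mbar) (Fin n)).Nonempty := by
  obtain ⟨D, h1, h2⟩ := exists_simonPair_definable hD hd hd'
  obtain ⟨x, ⟨-, hx⟩, hxN⟩ := SimonPair.con_of_not_con_compl (SimonPair.not_con_compl_inter
    (SimonPair.not_con_compl_of_isHonestSet hNIP hMbar hsat hκ hU h1 h hΘ)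
    (SimonPair.not_con_compl_of_isHonestSet hNIP hMbar hsat hκ hU h2 h' hΘ'))
    Set.univ Filter.univ_mem Set.definable_univ
  exact D.inter_tuples_nonempty (h1.inter h2) ⟨x, hx, hxN⟩

/-- The left side does not mention `D`, so this is the independence of the auxiliary models. Were
`Yᶜ` consistent, it too would be the trace of an honest set in `U`, although two honest sets in `U`
always meet in `M`. -/
theorem honestTrace_iff_not_con_compl {D : SimonPair M} {Y : Set (Fin n → Mbar)}
    (hY : (D.M' : Set Mbar).Definable L Y) : HonestTrace M U Y ↔ ¬ D.Con U Yᶜ := by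
  constructor
  · rintro ⟨Θ, hΘ, hd, hhon, htr⟩ hcon
    obtain ⟨Θ', hΘ', hd', hhon', htr'⟩ := D.exists_isHonestSet (Y := Yᶜ) (U := U) hNIP hMbar hsat hκ
      hY.compl (by
        rw [compl_compl]
        exact fun h => SimonPair.not_con_and_con_compl hNIP hMbar hsat hκ hU hY h hcon)
    obtain ⟨x, ⟨h1, h2⟩, h3⟩ := IsHonestSet.inter_tuples_nonempty hNIP hMbar hsat hκ hU hD hhon
      hhon' hΘ hΘ' hd (hd'.mono (Set.subset_univ _))
    exact (htr'.subset ⟨h2, h3⟩).1 (htr.subset ⟨h1, h3⟩).1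
  · intro h
    obtain ⟨Θ, hΘ, hd, hhon, htr⟩ := D.exists_isHonestSet hNIP hMbar hsat hκ hY h
    exact ⟨Θ, hΘ, hd.mono (Set.subset_univ _), hhon, htr⟩

/-- Sets with an honest trace are closed under intersection and meet `M`, and the dichotomy gives
the property to one of `Y`, `Yᶜ`. Adding the tuples from `M` to `V` is what makes the retract
finitely satisfiable in `M`. -/
theorem exists_ultrafilter_mem_iff_honestTrace : ∃ V : Ultrafilter (Fin n → Mbar),
    tuples (M : Set Mbar) (Fin n) ∈ V ∧
    ∀ Y, (Set.univ : Set Mbar).Definable L Y → (Y ∈ V ↔ HonestTrace M U Y) := by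
  obtain ⟨V, hV, hVM⟩ := exists_ultrafilter_of_inter_mem
    (𝒢 := {Y | (Set.univ : Set Mbar).Definable L Y ∧ HonestTrace M U Y})
    (Z := tuples (M : Set Mbar) (Fin n))
    ⟨Set.definable_univ, Set.univ, Filter.univ_mem, Set.definable_univ,
      (hD ∅).choose.isHonestSet_of_definable Set.definable_univ, rfl⟩ (by
      rintro Y ⟨hY, hY'⟩ Z ⟨hZ, hZ'⟩
      obtain ⟨D, h1, h2⟩ := exists_simonPair_definable hD hY hZ
      refine ⟨hY.inter hZ, ?_⟩
      rw [honestTrace_iff_not_con_compl hNIP hMbar hsat hκ hU hD h1] at hY'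
      rw [honestTrace_iff_not_con_compl hNIP hMbar hsat hκ hU hD h2] at hZ'
      rw [honestTrace_iff_not_con_compl hNIP hMbar hsat hκ hU hD (h1.inter h2)]
      exact SimonPair.not_con_compl_inter hY' hZ') (by
      rintro Y ⟨hY, Θ, hΘ, hd, hhon, htr⟩
      rw [← htr]
      have := IsHonestSet.inter_tuples_nonempty hNIP hMbar hsat hκ hU hD hhon hhon hΘ hΘ hd hd
      rwa [Set.inter_self] at this)
  refine ⟨V, hVM, fun Y hY => ⟨fun h => ?_, fun h => hV Y ⟨hY, h⟩⟩⟩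
  obtain ⟨D, h1, -⟩ := exists_simonPair_definable hD hY hY
  rw [honestTrace_iff_not_con_compl hNIP hMbar hsat hκ hU hD h1]
  intro hcon
  have h2 : HonestTrace M U Yᶜ := by
    rw [honestTrace_iff_not_con_compl hNIP hMbar hsat hκ hU hD h1.compl, compl_compl]
    exact fun h' => SimonPair.not_con_and_con_compl hNIP hMbar hsat hκ hU h1 h' hcon
  exact Ultrafilter.compl_mem_iff_notMem.1 (hV _ ⟨hY.compl, h2⟩) h

theorem isSimonRetract_iff {V : Ultrafilter (Fin n → Mbar)} {p F : TypeSpace L Mbar n}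
    (hp : IsTypeOf U p) (hF : IsTypeOf V F)
    (hV : ∀ Y, (Set.univ : Set Mbar).Definable L Y → (Y ∈ V ↔ HonestTrace M U Y))
    (q : TypeSpace L Mbar n) : IsSimonRetract M p q ↔ q = F := by
  classical
  constructor
  · intro hq
    refine typeSpace_eq_of_forall fun ψ hψ => ?_
    obtain ⟨B, hB⟩ := definable_solutionSet ψ
    have hY := hB.mono (Set.subset_univ _)
    obtain ⟨D, hD1, -⟩ := exists_simonPair_definable hD hY hY
    obtain ⟨ψ', hψ'⟩ := exists_solutionSet_withParams_eq hD1
    obtain ⟨W, hW⟩ := exists_isTypeOf_of_type q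
    rw [hF, hV _ hY, honestTrace_iff_not_con_compl hNIP hMbar hsat hκ hU hD hD1]
    -- Uniqueness: a formula of a retract `q` is consistent with `p|_N` and `P`, so by the dichotomy
    -- its negation is not.
    refine fun hcon => SimonPair.not_con_and_con_compl hNIP hMbar hsat hκ hU hD1 ?_ hcon
    intro X hX hXd
    obtain ⟨φ, rfl⟩ := exists_solutionSet_withParams_eq hXd
    obtain ⟨a, ha, hφ⟩ := hq D {withParams D.N φ, withParams D.M' ψ'} (by
      rw [Finset.coe_pair]
      rintro _ (rfl | rfl)
      · exact Or.inl ⟨(hp _).2 hX, φ, rfl⟩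
      · exact Or.inr ⟨(hW _).2 (by rw [hψ']; exact (hW ψ).1 hψ), ψ', rfl⟩)
    exact ⟨a, ⟨hφ _ (by simp), hψ'.subset (hφ _ (by simp))⟩, ha⟩
  · rintro rfl D Γ hΓ
    obtain ⟨W, hW, hWN⟩ := exists_ultrafilter_of_inter_mem
      (𝒢 := {Z | ∃ X ∈ U, D.N.Definable L X ∧ ∃ Y ∈ V, (D.M' : Set Mbar).Definable L Y ∧
        X ∩ Y = Z}) (Z := tuples D.N (Fin n))
      ⟨Set.univ, Filter.univ_mem, Set.definable_univ, Set.univ, Filter.univ_mem,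
        Set.definable_univ, Set.inter_univ _⟩ (by
        rintro _ ⟨X, hX, hXd, Y, hY, hYd, rfl⟩ _ ⟨X', hX', hXd', Y', hY', hYd', rfl⟩
        exact ⟨X ∩ X', Filter.inter_mem hX hX', hXd.inter hXd', Y ∩ Y', Filter.inter_mem hY hY',
          hYd.inter hYd', Set.inter_inter_inter_comm _ _ _ _⟩) (by
        rintro _ ⟨X, hX, hXd, Y, hY, hYd, rfl⟩
        have h1 := (hV Y (hYd.mono (Set.subset_univ _))).1 hY
        rw [honestTrace_iff_not_con_compl hNIP hMbar hsat hκ hU hD hYd] at h1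
        exact SimonPair.con_of_not_con_compl h1 X hX hXd)
    have hmem : ∀ φ ∈ Γ, solutionSet φ ∈ W := by
      intro φ hφ
      rcases hΓ hφ with ⟨h1, φ₀, rfl⟩ | ⟨h1, φ₀, rfl⟩
      · exact hW _ ⟨_, (hp _).1 h1, definable_solutionSet_withParams _ φ₀, Set.univ,
          Filter.univ_mem, Set.definable_univ, Set.inter_univ _⟩
      · exact hW _ ⟨Set.univ, Filter.univ_mem, Set.definable_univ, _, (hF _).1 h1,
          definable_solutionSet_withParams _ φ₀, Set.univ_inter _⟩
    obtain ⟨a, ha, haN⟩ := W.nonempty_of_mem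
      (Filter.inter_mem ((Filter.biInter_finset_mem Γ).2 hmem) hWN)
    exact ⟨a, haN, fun φ hφ => Set.mem_iInter₂.1 ha φ hφ⟩

end HonestTrace

/-! ### Closure of a point in the honest topology -/

section Closure

variable {L : FirstOrder.Language.{u, v}} {Mbar : Type w} [L.Structure Mbar] [Nonempty Mbar]
  {n : ℕ} {M : L.ElementarySubstructure Mbar}

theorem closure_singleton_eq {χ : L[[M]].Formula (Fin n)} (p : TypesOn M χ) :
    closure {p} = ⋂ θ ∈ {θ : L[[Mbar]].Formula (Fin n) | IsHonest M θ ∧ InType θ p.1},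
      typesContaining M χ θ := by
  refine Set.Subset.antisymm (closure_minimal ?_ ?_) fun q hq => ?_
  · exact Set.singleton_subset_iff.2 (Set.mem_iInter₂.2 fun θ hθ => hθ.2)
  · exact isClosed_biInter fun θ hθ =>
      ⟨TopologicalSpace.isOpen_generateFrom_of_mem ⟨θ, hθ.1, rfl⟩⟩
  -- Neighbourhoods of `q` need only be tested on the generating open sets, so closure of the sets
  -- `[θ]` under finite unions plays no role.
  · rw [← specializes_iff_mem_closure, Specializes, TopologicalSpace.nhds_generateFrom (a := q)]
    refine le_iInf₂ fun s hs => ?_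
    obtain ⟨hqs, θ, hθ, rfl⟩ := hs
    refine Filter.le_principal_iff.2 (IsOpen.mem_nhds
      (TopologicalSpace.isOpen_generateFrom_of_mem ⟨θ, hθ, rfl⟩) fun hp => hqs ?_)
    exact Set.mem_iInter₂.1 hq θ ⟨hθ, hp⟩

theorem honestTrace_solutionSet_iff {U : Ultrafilter (Fin n → Mbar)} {p : TypeSpace L Mbar n}
    (hp : IsTypeOf U p) (ψ : L[[Mbar]].Formula (Fin n)) : HonestTrace M U (solutionSet ψ) ↔
      ∃ θ : L[[Mbar]].Formula (Fin n), IsHonest M θ ∧ InType θ p ∧ trace M θ = trace M ψ := by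
  constructor
  · rintro ⟨Θ, hΘ, hd, hhon, htr⟩
    obtain ⟨θ, rfl⟩ := exists_solutionSet_withParams_eq hd
    exact ⟨_, (isHonest_iff _).2 hhon, (hp _).2 hΘ, by rw [trace_eq, trace_eq, htr]⟩
  · rintro ⟨θ, hθ, hpθ, htr⟩
    obtain ⟨B, hB⟩ := definable_solutionSet θ
    exact ⟨_, (hp θ).1 hpθ, hB.mono (Set.subset_univ _), (isHonest_iff θ).1 hθ, by
      rw [← trace_eq, ← trace_eq, htr]⟩

end Closure

end Honest

/-! ### The theorem -/

theorem mainTheorem5 {L : FirstOrder.Language.{u, v}} (T : L.Theory) (hT : T.IsComplete)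
    (hNIP : Honest.IsNIP.{u, v, w} T)
    {Mbar : Type w} [L.Structure Mbar] [Nonempty Mbar] (hMbar : Mbar ⊨ T)
    (M : L.ElementarySubstructure Mbar)
    (κ : Cardinal.{w})
    (hκ : (2 : Cardinal.{max u v w}) ^ ((2 : Cardinal.{max u v w}) ^
        max ℵ₀ (max (Cardinal.lift.{max u v, w} #M) (Cardinal.lift.{w, max u v} L.card))) <
      Cardinal.lift.{max u v, w} κ)
    (hsat : Honest.IsMonster L κ Mbar)
    {n : ℕ} (χ : L[[M]].Formula (Fin n))
    (p : Honest.TypesOn M χ) (hp : Honest.IsInvariant M p.1) :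
    ∃ F : Honest.TypesOn M χ,
      (∀ q : Honest.TypeSpace L Mbar n, Honest.IsSimonRetract M p.1 q ↔ q = F.1) ∧
      Honest.IsFinSat M F.1 ∧
      (∀ ψ : L[[Mbar]].Formula (Fin n), Honest.InType ψ F.1 ↔
        ∃ θ : L[[Mbar]].Formula (Fin n), Honest.IsHonest M θ ∧ Honest.InType θ p.1 ∧
          Honest.trace M θ = Honest.trace M ψ) ∧
      F ∈ closure {p} ∧
      closure {p} =
        ⋂ θ ∈ {θ : L[[Mbar]].Formula (Fin n) | Honest.IsHonest M θ ∧ Honest.InType θ p.1},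
          Honest.typesContaining M χ θ := by
  have hc := ((Cardinal.cantor _).trans (Cardinal.cantor _)).trans hκ
  -- The maximum `λ` lives in a larger universe than `κ`, but lying below a lift it is itself the
  -- lift of some `l` in the universe of `Mbar`.
  obtain ⟨l, hl⟩ := Cardinal.mem_range_lift_of_le hc.le
  rw [← hl] at hκ hc
  have hl0 : ℵ₀ ≤ l := by
    rw [← Cardinal.aleph0_le_lift.{w, max u v}, hl]
    exact le_max_left _ _
  have hlM : #M ≤ l := by
    rw [← Cardinal.lift_le.{max u v}, hl]
    exact (le_max_left _ _).trans (le_max_right _ _)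
  have hlL : Cardinal.lift.{w} L.card ≤ Cardinal.lift.{max u v} l := by
    rw [hl]
    exact (le_max_right _ _).trans (le_max_right _ _)
  have hlκ : l < κ := Cardinal.lift_lt.1 hc
  have hpow : 2 ^ (2 : Cardinal.{w}) ^ l < κ := by
    rw [← Cardinal.lift_lt.{w, max u v}, Cardinal.lift_two_power, Cardinal.lift_two_power]
    exact hκ
  have hκ0 := hl0.trans_lt hlκ
  have hD := Honest.exists_simonPair hsat.saturated hl0 hlL hpow M hlM
  obtain ⟨U, hU⟩ := Honest.exists_isTypeOf_of_type p.1
  have hinv := hp.invariantOver (hsat.isStronglyHomogeneous hκ0) hκ0.le (hlM.trans_lt hlκ) hU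
  obtain ⟨V, hVM, hV⟩ := Honest.exists_ultrafilter_mem_iff_honestTrace hNIP hMbar hsat.saturated
    hκ0 hinv hD
  obtain ⟨F, hF⟩ := Honest.exists_isTypeOf_of_ultrafilter (L := L) V
  have hmem : ∀ ψ : L[[Mbar]].Formula (Fin n), Honest.InType ψ F ↔
      ∃ θ : L[[Mbar]].Formula (Fin n), Honest.IsHonest M θ ∧ Honest.InType θ p.1 ∧
        Honest.trace M θ = Honest.trace M ψ := by
    intro ψ
    obtain ⟨B, hB⟩ := Honest.definable_solutionSet ψ
    rw [hF, hV _ (hB.mono (Set.subset_univ _)), Honest.honestTrace_solutionSet_iff hU]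
  have hθ : ∀ θ, Honest.IsHonest M θ → Honest.InType θ p.1 → Honest.InType θ F :=
    fun θ h h' => (hmem θ).2 ⟨θ, h, h', rfl⟩
  have hχ : Honest.InType (Honest.ofModel M χ) F :=
    hθ _ ((Honest.isHonest_iff _).2 ((hD ∅).choose.isHonestSet_of_definable
      (Honest.definable_solutionSet_withParams (M : Set Mbar) χ))) p.2
  refine ⟨⟨F, hχ⟩, Honest.isSimonRetract_iff hNIP hMbar hsat.saturated hκ0 hinv hD hU hF hV, ?_,
    hmem, ?_, Honest.closure_singleton_eq p⟩
  · intro ψ hψ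
    rw [Honest.trace_eq]
    exact V.nonempty_of_mem (Filter.inter_mem ((hF ψ).1 hψ) hVM)
  · rw [Honest.closure_singleton_eq]
    exact Set.mem_iInter₂.2 fun θ h => hθ θ h.1 h.2
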